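/- Let $M\ge 2$ be an integer and $\Delta=(0,\frac1M)\times(0,\frac1M)$. Let $D=\{\alpha_1,\dots,\alpha_M,\beta_1,\dots,\beta_M\}$. **The maps.** For $(a,b)\in\Delta$ and $1\le k\le M$ let $\Omega_{\alpha_k}=[(k-1)a,ka)\times[0,1]\times[0,1]$ and $\Omega_{\beta_k}=[Ma,1]\times J_k\times[0,1]$, where $J_k=[\frac{k-1}M,\frac kM)$ for $k<M$ and $J_M=[\frac{M-1}M,1]$. These sets partition $[0,1]^3$. The heterochaos baker map $f_{a,b}\colon[0,1]^3\to[0,1]^3$ is $$f_{a,b}(x_u,x_c,x_s)=\begin{cases}\left(\frac{x_u-(k-1)a}{a},\ \frac{x_c}{M}+\frac{k-1}{M},\ (1-Mb)x_s\right)&\text{on }\Omega_{\alpha_k},\\[1mm]\left(\frac{x_u-Ma}{1-Ma},\ Mx_c-k+1,\ bx_s+1+b(k-M-1)\right)&\text{on }\Omega_{\beta_k}.\end{cases}$$ For $\omega\in D^{\mathbb Z}$ let $\pi_{a,b}^{-1}(\omega)=\bigcap_{n\in\mathbb Z}f_{a,b}^{-n}(\mathrm{int}\,\Omega_{\omega_n})$,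 the set of points with code $\omega$ (for $n<0$, $f^{-n}$ of a set is its image under the iterate $f^{|n|}$). **The measures.** Let $\lambda_\alpha$ and $\lambda_\beta$ be the $(\frac1{M+1},\dots,\frac1{M+1})$-Bernoulli measures on $\{\alpha_1,\dots,\alpha_M,\beta\}^{\mathbb Z}$ and $\{\alpha,\beta_1,\dots,\beta_M\}^{\mathbb Z}$. Regard every $\alpha$-symbol as a left bracket and every $\beta$-symbol as a right bracket. For $\lambda_\alpha$-almost every $\zeta$ each right bracket closes a left one; let $\psi_\alpha(\zeta)\in D^{\mathbb Z}$ be obtained from $\zeta$ by replacing each $\beta$ by $\beta_k$, where $\alpha_k$ is the left bracket that it closes. For $\lambda_\beta$-almost every $\zeta$ each left bracket is closed by a right one; let $\psi_\beta(\zeta)\in D^{\mathbb Z}$ be obtained from $\zeta$ by replacing each $\alpha$ by $\alpha_k$, where $\beta_k$ is the right bracket that closes it. For $\gamma\in\{\alpha,\beta\}$ put $\nu_\gamma=\lambda_\gamma\circ\psi_\gamma^{-1}$, a Borel probability measure on $D^{\mathbb Z}$. For $\nu_\gamma$-almost every $\omega$ the set $\pi_{a,b}^{-1}(\omega)$ is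 a single point, and $\mu_{\gamma,a,b}=\nu_\gamma\circ\pi_{a,b}$ denotes the image of $\nu_\gamma$ under $\omega\mapsto\pi_{a,b}^{-1}(\omega)$. (These are the two ergodic measures of maximal entropy of $f_{a,b}$.) **Theorem.** Let $M(X)$ be the space of Borel probability measures on $X$ with the weak* topology, and let $p\colon[0,1]^3\to[0,1]^2$, $p(x_u,x_c,x_s)=(x_u,x_c)$. (i) The maps $(a,b)\in\Delta\mapsto\mu_{\alpha,a,b}\in M([0,1]^3)$ and $(a,b)\in\Delta\mapsto\mu_{\beta,a,b}\in M([0,1]^3)$ are (well defined and) continuous. (ii) For every $b\in(0,\frac1M)$ the maps $a\in(0,\frac1M)\mapsto\mu_{\alpha,a,b}\circ p^{-1}\in M([0,1]^2)$ and $a\in(0,\frac1M)\mapsto\mu_{\beta,a,b}\circ p^{-1}\in M([0,1]^2)$ are continuous. -/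

import Mathlib

open MeasureTheory Set

noncomputable section

namespace HeterochaosBaker

/-! The parameters are `M` (an integer, at least two), and `a`, `b` in `(0, 1/M)`.
Indices `k` in `{1, …, M}` are represented by `Fin M`, shifted by one: the element `k` of `Fin M`
stands for the index `k + 1`. -/

/-- The alphabet of `2M` symbols: `Sum.inl k` is the left bracket `α_{k+1}`, and `Sum.inr k`
the right bracket `β_{k+1}`. -/
abbrev Symb (M : ℕ) : Type := Fin M ⊕ Fin M

/-- The parameter space `(0, 1/M) × (0, 1/M)`. -/
def Delta (M : ℕ) : Set (ℝ × ℝ) := Ioo 0 (1 / (M : ℝ)) ×ˢ Ioo 0 (1 / (M : ℝ))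

/-! ### The map -/

/-- The domain `Ω_γ` in the cube, with coordinates `(x_u, x_c, x_s)`. -/
def Omega (M : ℕ) (a : ℝ) : Symb M → Set (ℝ × ℝ × ℝ)
  | Sum.inl k => Ico ((k : ℝ) * a) (((k : ℝ) + 1) * a) ×ˢ Icc 0 1 ×ˢ Icc 0 1
  | Sum.inr k => Icc ((M : ℝ) * a) 1 ×ˢ
      (if (k : ℕ) + 1 = M then Icc (((M : ℝ) - 1) / M) 1
        else Ico ((k : ℝ) / M) (((k : ℝ) + 1) / M)) ×ˢ Icc 0 1

/-- The affine branch of the baker map on `Ω_γ`. -/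
def branch (M : ℕ) (a b : ℝ) : Symb M → ℝ × ℝ × ℝ → ℝ × ℝ × ℝ
  | Sum.inl k => fun x =>
      ((x.1 - k * a) / a, x.2.1 / M + k / M, (1 - M * b) * x.2.2)
  | Sum.inr k => fun x =>
      ((x.1 - M * a) / (1 - M * a), M * x.2.1 - k, b * x.2.2 + 1 + b * ((k : ℝ) - M))

open Classical in
/-- The heterochaos baker map `f_{a,b}`: the affine branch of `γ` on each `Ω_γ`. The domains `Ω_γ`
are pairwise disjoint and cover the cube `[0,1]³`; outside the cube, where the map is of no
interest, it is extended by the identity. -/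
def baker (M : ℕ) (a b : ℝ) (x : ℝ × ℝ × ℝ) : ℝ × ℝ × ℝ :=
  if h : ∃ γ : Symb M, x ∈ Omega M a γ then branch M a b h.choose x else x

/-- The set `f^{-n}(S)` for an integer `n`: the preimage of `S` under `f^n` if `n ≥ 0`, the image
of `S` under `f^{-n}` if `n < 0`. -/
def preIter {X : Type*} (f : X → X) : ℤ → Set X → Set X
  | Int.ofNat n, S => f^[n] ⁻¹' S
  | Int.negSucc n, S => f^[n + 1] '' S

/-! ### The coding -/

/-- The fibre `π_{a,b}⁻¹(ω)` of the coding map: the set of all points `x` that lie in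
`f^{-n}(int Ω_{ω_n})` for every integer `n`. -/
def codingFibre (M : ℕ) (a b : ℝ) (ω : ℤ → Symb M) : Set (ℝ × ℝ × ℝ) :=
  ⋂ n : ℤ, preIter (baker M a b) n (interior (Omega M a (ω n)))

/-- The cube `[0,1]³`, as a space. -/
abbrev Cube : Type := unitInterval × unitInterval × unitInterval

/-- The square `[0,1]²`, as a space. -/
abbrev Square : Type := unitInterval × unitInterval

/-- The inclusion of the cube into `ℝ³`. -/
def Cube.toReal (x : Cube) : ℝ × ℝ × ℝ := ((x.1 : ℝ), (x.2.1 : ℝ), (x.2.2 : ℝ))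

/-- The projection to the `(x_u, x_c)`-plane. -/
def proj (x : Cube) : Square := (x.1, x.2.1)

lemma measurable_proj : Measurable proj :=
  measurable_fst.prodMk (measurable_fst.comp measurable_snd)

open Classical in
/-- The inverse of the coding map: a point with code `ω`, and the corner `0` if there is none.
(For almost every `ω` with respect to each of the two measures below there is precisely one.) -/
def decode (M : ℕ) (a b : ℝ) (ω : ℤ → Symb M) : Cube :=
  if h : ∃ x : Cube, x.toReal ∈ codingFibre M a b ω then h.choose else 0

/-! ### The two measures on the shift space -/

/-- The value of a symbol: `1` for left brackets and `-1` for right brackets. -/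
def bracketSign {A B : Type} : A ⊕ B → ℤ
  | Sum.inl _ => 1
  | Sum.inr _ => -1

/-- The height `H_i(ζ)`: the sum of the bracket signs over `0 ≤ j < i` if `i ≥ 0`, and minus the sum
of the bracket signs over `i ≤ j < 0` if `i < 0`. -/
def height {A B : Type} (ζ : ℤ → A ⊕ B) (i : ℤ) : ℤ :=
  (∑ j ∈ Finset.Ico 0 i, bracketSign (ζ j)) - ∑ j ∈ Finset.Ico i 0, bracketSign (ζ j)

/-- The alphabet `{α_1, …, α_M, β}`. -/
abbrev SymbAlpha (M : ℕ) : Type := Fin M ⊕ Unit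

/-- The alphabet `{α, β_1, …, β_M}`. -/
abbrev SymbBeta (M : ℕ) : Type := Unit ⊕ Fin M

/-- The `(1/(M+1), …, 1/(M+1))`-Bernoulli measure on `{α_1, …, α_M, β}^ℤ`. -/
def lambdaAlpha (M : ℕ) : Measure (ℤ → SymbAlpha M) :=
  Measure.infinitePi fun _ : ℤ => (PMF.uniformOfFintype (SymbAlpha M)).toMeasure

/-- The `(1/(M+1), …, 1/(M+1))`-Bernoulli measure on `{α, β_1, …, β_M}^ℤ`. -/
def lambdaBeta (M : ℕ) : Measure (ℤ → SymbBeta M) :=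
  Measure.infinitePi fun _ : ℤ => (PMF.uniformOfFintype (SymbBeta M)).toMeasure

/-- The position of the left bracket that is closed by the right bracket at position `i`: the
largest `j < i + 1` with `H_j = H_{i+1}`. -/
def matchLeft {A B : Type} (ζ : ℤ → A ⊕ B) (i : ℤ) : ℤ :=
  sSup {j : ℤ | j < i + 1 ∧ height ζ j = height ζ (i + 1)}

/-- The position of the right bracket that closes the left bracket at position `i`: it is
`j - 1`, for the smallest `j > i` with `H_j = H_i`. -/
def matchRight {A B : Type} (ζ : ℤ → A ⊕ B) (i : ℤ) : ℤ :=
  sInf {j : ℤ | i < j ∧ height ζ j = height ζ i} - 1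

/-- The map `ψ_α`: each `β` becomes `β_k`, where `α_k` is the left bracket that it closes. The
default value `β_1` is taken only by those `β` that close no left bracket (for almost no sequence
is there one). -/
def psiAlpha (M : ℕ) [NeZero M] (ζ : ℤ → SymbAlpha M) (i : ℤ) : Symb M :=
  match ζ i with
  | Sum.inl k => Sum.inl k
  | Sum.inr _ => match ζ (matchLeft ζ i) with
    | Sum.inl k => Sum.inr k
    | Sum.inr _ => Sum.inr 0

/-- The map `ψ_β`: each `α` becomes `α_k`, where `β_k` is the right bracket that closes it. The
default value `α_1` is taken only by those `α` that no right bracket closes (for almost no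
sequence is there one). -/
def psiBeta (M : ℕ) [NeZero M] (ζ : ℤ → SymbBeta M) (i : ℤ) : Symb M :=
  match ζ i with
  | Sum.inr k => Sum.inr k
  | Sum.inl _ => match ζ (matchRight ζ i) with
    | Sum.inr k => Sum.inl k
    | Sum.inl _ => Sum.inl 0

/-- The ergodic measure of maximal entropy `ν_α = λ_α ∘ ψ_α⁻¹` of the Dyck shift. -/
def nuAlpha (M : ℕ) [NeZero M] : Measure (ℤ → Symb M) := (lambdaAlpha M).map (psiAlpha M)

/-- The ergodic measure of maximal entropy `ν_β = λ_β ∘ ψ_β⁻¹` of the Dyck shift. -/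
def nuBeta (M : ℕ) [NeZero M] : Measure (ℤ → Symb M) := (lambdaBeta M).map (psiBeta M)

/-! ### The two measures on the cube -/

/-- The measure `μ_{α,a,b} = ν_α ∘ π_{a,b}`, the image of `ν_α` under the inverse of the coding
map. -/
def muAlpha (M : ℕ) [NeZero M] (a b : ℝ) : Measure Cube := (nuAlpha M).map (decode M a b)

/-- The measure `μ_{β,a,b} = ν_β ∘ π_{a,b}`, the image of `ν_β` under the inverse of the coding
map. -/
def muBeta (M : ℕ) [NeZero M] (a b : ℝ) : Measure Cube := (nuBeta M).map (decode M a b)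

end HeterochaosBaker

end

/-!
The baker map acts on the three coordinates separately once the code `ω` of an orbit is given, and
the two-sided orbit of a point with code `ω` can be written down one coordinate at a time.

* The inverse branches contract the `x_u`-coordinate, so `x_u` is a convergent series in the symbols
  of the future, with coefficients that depend on `a` only; likewise the branches contract `x_s`,
  which is a series in the symbols of the past, with coefficients that depend on `b` only
  (`affineSeries`, `coordU`, `coordS`).
* The `x_c`-coordinate does not depend on the parameters at all: a left bracket `α_k` prepends the
  `M`-ary digit `k` to `x_c`, and the matching right bracket `β_k` deletes it again. Hence the
  digits of `x_c` are the indices of the left brackets that are still open (`centralCoord`). Conversely,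
  the difference of two possible sequences of `x_c`-coordinates scales by the powers of `M` to the
  heights, so it vanishes if the heights are unbounded below in the past.

Consequently the fibre over a code is a single point as soon as brackets of both kinds occur
arbitrarily far in both directions and `x_c` is determined and stays in `(0,1)` (`IsRegular`,
`toReal_decode`). For `ν_α` this holds almost surely: the heights tend to `-∞` in the past by the
law of large numbers, and every index occurs among the open brackets, because given the positions of the
left brackets their indices are independent and uniform (`ae_exists_stackDigit_eq`). The measure
`ν_β` is the image of `ν_α` under time reversal combined with the exchange of `α_k` and `β_k`, which
preserves regularity (`nuBeta_eq_map_flip`, `IsRegular.flip`).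

So off a null set of codes, which is the same for all parameters, the decoded point is a continuous
function of `(a,b)`, and continuity of the image measures follows by dominated convergence
(`exists_continuous_map_decode`). The projected measures depend continuously on `a` because taking
images under a continuous map is weak* continuous.
-/

namespace HeterochaosBaker

open Filter Topology

/-! ### Infinite compositions of affine contractions -/

/-- The value `t₀ + r₀ (t₁ + r₁ (t₂ + ⋯))` of the infinite composition of the affine maps
`x ↦ t_n + r_n x`. -/
noncomputable def affineSeries (r t : ℕ → ℝ) : ℝ := ∑' n, (∏ i ∈ Finset.range n, r i) * t n

/-- The affine maps `x ↦ t_n + r_n x` are increasing, map `[0,1]` to itself, and contract by the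
uniform factor `ρ < 1`. -/
structure IsContracting (ρ : ℝ) (r t : ℕ → ℝ) : Prop where
  lt_one : ρ < 1
  rate_pos : ∀ n, 0 < r n
  rate_le : ∀ n, r n ≤ ρ
  shift_nonneg : ∀ n, 0 ≤ t n
  add_le : ∀ n, r n + t n ≤ 1

namespace IsContracting

variable {ρ : ℝ} {r t : ℕ → ℝ}

lemma pos (h : IsContracting ρ r t) : 0 < ρ := (h.rate_pos 0).trans_le (h.rate_le 0)

lemma drop (h : IsContracting ρ r t) (k : ℕ) :
    IsContracting ρ (fun n => r (n + k)) (fun n => t (n + k)) :=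
  ⟨h.lt_one, fun _ => h.rate_pos _, fun _ => h.rate_le _, fun _ => h.shift_nonneg _,
    fun _ => h.add_le _⟩

/-- Conjugation by the reflection `x ↦ 1 - x`. -/
lemma reflect (h : IsContracting ρ r t) : IsContracting ρ r (fun n => 1 - r n - t n) :=
  ⟨h.lt_one, h.rate_pos, h.rate_le, fun n => by linarith [h.add_le n],
    fun n => by linarith [h.shift_nonneg n]⟩

lemma prod_le (h : IsContracting ρ r t) (n : ℕ) : ∏ i ∈ Finset.range n, r i ≤ ρ ^ n := by
  calc ∏ i ∈ Finset.range n, r i ≤ ∏ _i ∈ Finset.range n, ρ :=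
        Finset.prod_le_prod (fun i _ => (h.rate_pos i).le) (fun i _ => h.rate_le i)
    _ = ρ ^ n := by simp

lemma term_nonneg (h : IsContracting ρ r t) (n : ℕ) : 0 ≤ (∏ i ∈ Finset.range n, r i) * t n :=
  mul_nonneg (Finset.prod_nonneg fun i _ => (h.rate_pos i).le) (h.shift_nonneg n)

lemma term_le (h : IsContracting ρ r t) (n : ℕ) : (∏ i ∈ Finset.range n, r i) * t n ≤ ρ ^ n := by
  have h1 : t n ≤ 1 := by linarith [h.add_le n, h.rate_pos n]
  calc (∏ i ∈ Finset.range n, r i) * t n ≤ ρ ^ n * 1 :=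
        mul_le_mul (h.prod_le n) h1 (h.shift_nonneg n) (pow_nonneg h.pos.le n)
    _ = ρ ^ n := mul_one _

lemma summable (h : IsContracting ρ r t) :
    Summable fun n => (∏ i ∈ Finset.range n, r i) * t n :=
  Summable.of_nonneg_of_le h.term_nonneg h.term_le
    (summable_geometric_of_lt_one h.pos.le h.lt_one)

lemma affineSeries_eq (h : IsContracting ρ r t) :
    affineSeries r t = t 0 + r 0 * affineSeries (fun n => r (n + 1)) (fun n => t (n + 1)) := by
  unfold affineSeries
  rw [h.summable.tsum_eq_zero_add, ← tsum_mul_left]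
  simp only [Finset.range_zero, Finset.prod_empty, one_mul, Finset.prod_range_succ']
  congr 2
  ext n
  ring

lemma affineSeries_nonneg (h : IsContracting ρ r t) : 0 ≤ affineSeries r t :=
  tsum_nonneg h.term_nonneg

/-- The affine series is the only bounded backward orbit of the affine maps. -/
lemma eq_affineSeries (h : IsContracting ρ r t) {v : ℕ → ℝ} (hv : ∀ n, v n ∈ Icc (0 : ℝ) 1)
    (hrec : ∀ n, v n = t n + r n * v (n + 1)) : v 0 = affineSeries r t := by
  have key : ∀ n, v 0 = ∑ m ∈ Finset.range n, (∏ i ∈ Finset.range m, r i) * t m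
      + (∏ i ∈ Finset.range n, r i) * v n := by
    intro n
    induction n with
    | zero => simp
    | succ n ih =>
      rw [ih, Finset.sum_range_succ, Finset.prod_range_succ, hrec n]
      ring
  have h0 : Tendsto (fun n => (∏ i ∈ Finset.range n, r i) * v n) atTop (𝓝 0) := by
    refine squeeze_zero (fun n => mul_nonneg
      (Finset.prod_nonneg fun i _ => (h.rate_pos i).le) (hv n).1) (fun n => ?_)
      (tendsto_pow_atTop_nhds_zero_of_lt_one h.pos.le h.lt_one)
    calc (∏ i ∈ Finset.range n, r i) * v n ≤ ρ ^ n * 1 :=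
        mul_le_mul (h.prod_le n) (hv n).2 (hv n).1 (pow_nonneg h.pos.le n)
      _ = ρ ^ n := mul_one _
  have h1 := h.summable.hasSum.tendsto_sum_nat.add h0
  rw [add_zero] at h1
  refine tendsto_nhds_unique (tendsto_const_nhds.congr fun n => ?_) h1
  exact key n

lemma affineSeries_le_one (h : IsContracting ρ r t) : affineSeries r t ≤ 1 := by
  have hg : ∀ n, ∑ m ∈ Finset.range n, (∏ i ∈ Finset.range m, r i) * t m
      + (∏ i ∈ Finset.range n, r i) ≤ 1 := by
    intro n
    induction n with
    | zero => simp
    | succ n ih =>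
      rw [Finset.sum_range_succ, Finset.prod_range_succ]
      nlinarith [h.add_le n, Finset.prod_nonneg fun i (_ : i ∈ Finset.range n) => (h.rate_pos i).le]
  refine le_of_tendsto' h.summable.hasSum.tendsto_sum_nat fun n => ?_
  linarith [hg n, Finset.prod_nonneg fun i (_ : i ∈ Finset.range n) => (h.rate_pos i).le]

lemma affineSeries_pos (h : IsContracting ρ r t) (ht : ∃ n, 0 < t n) : 0 < affineSeries r t := by
  obtain ⟨n, hn⟩ := ht
  exact h.summable.tsum_pos h.term_nonneg n
    (mul_pos (Finset.prod_pos fun i _ => h.rate_pos i) hn)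

lemma affineSeries_reflect (h : IsContracting ρ r t) :
    1 - affineSeries r t = affineSeries r (fun n => 1 - r n - t n) := by
  have hs := h.drop
  refine h.reflect.eq_affineSeries
    (v := fun k => 1 - affineSeries (fun n => r (n + k)) (fun n => t (n + k))) (fun k => ?_)
    (fun k => ?_)
  · exact ⟨by linarith [(hs k).affineSeries_le_one], by linarith [(hs k).affineSeries_nonneg]⟩
  · have h1 := (hs k).affineSeries_eq
    simp only [zero_add] at h1
    have h2 : ∀ q : ℕ → ℝ, (fun n => q (n + 1 + k)) = fun n => q (n + (k + 1)) :=
      fun q => funext fun n => by rw [add_assoc, add_comm 1 k]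
    rw [h2 r, h2 t] at h1
    simp only [h1]
    ring

lemma affineSeries_mem_Ioo (h : IsContracting ρ r t) (h0 : ∃ n, 0 < t n)
    (h1 : ∃ n, r n + t n < 1) : affineSeries r t ∈ Ioo (0 : ℝ) 1 := by
  refine ⟨h.affineSeries_pos h0, ?_⟩
  have : 0 < affineSeries r (fun n => 1 - r n - t n) :=
    h.reflect.affineSeries_pos (h1.imp fun n hn => by linarith)
  linarith [h.affineSeries_reflect]

end IsContracting

lemma continuousOn_affineSeries {X : Type*} [TopologicalSpace X] {s : Set X} {ρ : ℝ}
    {r t : X → ℕ → ℝ} (h : ∀ x ∈ s, IsContracting ρ (r x) (t x))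
    (hr : ∀ n, ContinuousOn (fun x => r x n) s) (ht : ∀ n, ContinuousOn (fun x => t x n) s) :
    ContinuousOn (fun x => affineSeries (r x) (t x)) s := by
  rcases s.eq_empty_or_nonempty with rfl | ⟨x₀, hx₀⟩
  · exact continuousOn_empty _
  refine continuousOn_tsum (u := fun n => ρ ^ n)
    (fun n => (continuousOn_finsetProd _ fun i _ => hr i).mul (ht n))
    (summable_geometric_of_lt_one (h x₀ hx₀).pos.le (h x₀ hx₀).lt_one) fun n x hx => ?_
  rw [Real.norm_of_nonneg ((h x hx).term_nonneg n)]
  exact (h x hx).term_le n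

lemma measurable_affineSeries {Ω : Type*} [MeasurableSpace Ω] {r t : Ω → ℕ → ℝ}
    (hs : ∀ ω, Summable fun n => (∏ i ∈ Finset.range n, r ω i) * t ω n)
    (hr : ∀ n, Measurable fun ω => r ω n) (ht : ∀ n, Measurable fun ω => t ω n) :
    Measurable fun ω => affineSeries (r ω) (t ω) := by
  refine measurable_of_tendsto_metrizable
    (f := fun (n : ℕ) ω => ∑ m ∈ Finset.range n, (∏ i ∈ Finset.range m, r ω i) * t ω m)
    (fun n => Finset.measurable_fun_sum _ fun m _ =>
      (Finset.measurable_fun_prod _ fun i _ => hr i).mul (ht m)) ?_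
  rw [tendsto_pi_nhds]
  exact fun ω => (hs ω).hasSum.tendsto_sum_nat

/-! ### Points with a given code -/

section Fibre

variable {M : ℕ} {a b : ℝ}

/-- The slope in `x_u` of the inverse branch of `γ`. -/
noncomputable def rateU (M : ℕ) (a : ℝ) : Symb M → ℝ
  | Sum.inl _ => a
  | Sum.inr _ => 1 - M * a

/-- The translation part in `x_u` of the inverse branch of `γ`. -/
noncomputable def shiftU (M : ℕ) (a : ℝ) : Symb M → ℝ
  | Sum.inl k => k * a
  | Sum.inr _ => M * a

/-- The slope in `x_s` of the branch of `γ`. -/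
noncomputable def rateS (M : ℕ) (b : ℝ) : Symb M → ℝ
  | Sum.inl _ => 1 - M * b
  | Sum.inr _ => b

/-- The translation part in `x_s` of the branch of `γ`. -/
noncomputable def shiftS (M : ℕ) (b : ℝ) : Symb M → ℝ
  | Sum.inl _ => 0
  | Sum.inr k => 1 + b * ((k : ℝ) - M)

/-- The branch of `γ` takes the `x_c`-coordinate `c` to `c'`. For right brackets the relation is
solved for `c`, so that reversing time and exchanging the brackets `α_k` and `β_k` preserves it. -/
def CentralStep (M : ℕ) : Symb M → ℝ → ℝ → Prop
  | Sum.inl k, c, c' => c' = (c + k) / M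
  | Sum.inr k, c, c' => c = (c' + k) / M

/-- The sequence `c` is a possible sequence of `x_c`-coordinates of an orbit with code `ω`. -/
def IsCentralOrbit (ω : ℤ → Symb M) (c : ℤ → ℝ) : Prop :=
  ∀ n, c n ∈ Ioo (0 : ℝ) 1 ∧ CentralStep M (ω n) (c n) (c (n + 1))

/-- The `x_u`-coordinate at time `n` of the point with code `ω`; it depends on the future only. -/
noncomputable def coordU (M : ℕ) (a : ℝ) (ω : ℤ → Symb M) (n : ℤ) : ℝ :=
  affineSeries (fun i : ℕ => rateU M a (ω (n + i))) (fun i : ℕ => shiftU M a (ω (n + i)))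

/-- The `x_s`-coordinate at time `n` of the point with code `ω`; it depends on the past only. -/
noncomputable def coordS (M : ℕ) (b : ℝ) (ω : ℤ → Symb M) (n : ℤ) : ℝ :=
  affineSeries (fun i : ℕ => rateS M b (ω (n - 1 - i))) (fun i : ℕ => shiftS M b (ω (n - 1 - i)))

/-- Brackets of both kinds occur arbitrarily far in the future and in the past, and the
`x_c`-coordinate of the points with code `ω` can only be `C`. This makes the fibre of the coding map
a single point, whatever the parameters. -/
structure IsRegular (ω : ℤ → Symb M) (C : ℝ) : Prop where
  left_future : ∀ n : ℤ, ∃ i : ℕ, (ω (n + i)).isLeft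
  right_future : ∀ n : ℤ, ∃ i : ℕ, (ω (n + i)).isRight
  left_past : ∀ n : ℤ, ∃ i : ℕ, (ω (n - 1 - i)).isLeft
  right_past : ∀ n : ℤ, ∃ i : ℕ, (ω (n - 1 - i)).isRight
  exists_central : ∃ c, IsCentralOrbit ω c
  central_unique : ∀ c, IsCentralOrbit ω c → c 0 = C

lemma fin_cast_add_one_le (k : Fin M) : (k : ℝ) + 1 ≤ M := by exact_mod_cast k.2

lemma natCast_pos_of_fin (k : Fin M) : (0 : ℝ) < M := by
  linarith [fin_cast_add_one_le k, (Nat.cast_nonneg (k : ℕ) : (0 : ℝ) ≤ (k : ℕ))]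

lemma natCast_pos_of_symb : Symb M → (0 : ℝ) < M
  | Sum.inl k => natCast_pos_of_fin k
  | Sum.inr k => natCast_pos_of_fin k

lemma fin_eq_of_abs_sub_lt {k k' : Fin M} {x y : ℝ} (h : x + k = y + k') (h1 : |x - y| < 1) :
    k = k' := by
  rw [abs_lt] at h1
  have h2 : ((k : ℕ) : ℝ) < (k' : ℕ) + 1 := by linarith
  have h3 : ((k' : ℕ) : ℝ) < (k : ℕ) + 1 := by linarith
  have h4 : (k : ℕ) < k' + 1 := by exact_mod_cast h2
  have h5 : (k' : ℕ) < k + 1 := by exact_mod_cast h3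
  exact Fin.ext (by omega)

lemma isContracting_u {ρ : ℝ} (ha : a ∈ Ioo 0 (1 / (M : ℝ))) (h0 : a ≤ ρ) (h1 : 1 - M * a ≤ ρ)
    (hρ : ρ < 1) (s : ℕ → Symb M) :
    IsContracting ρ (fun i => rateU M a (s i)) (fun i => shiftU M a (s i)) := by
  have hM := natCast_pos_of_symb (s 0)
  have hMa : M * a < 1 := by
    have := ha.2; rw [lt_div_iff₀ hM] at this; linarith
  have ha0 := ha.1
  refine ⟨hρ, fun n => ?_, fun n => ?_, fun n => ?_, fun n => ?_⟩ <;>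
    rcases s n with k | k <;> simp only [rateU, shiftU]
  · exact ha0
  · linarith
  · exact h0
  · exact h1
  · positivity
  · positivity
  · nlinarith [fin_cast_add_one_le k]
  · linarith

lemma isContracting_s {ρ : ℝ} (hb : b ∈ Ioo 0 (1 / (M : ℝ))) (h0 : b ≤ ρ) (h1 : 1 - M * b ≤ ρ)
    (hρ : ρ < 1) (s : ℕ → Symb M) :
    IsContracting ρ (fun i => rateS M b (s i)) (fun i => shiftS M b (s i)) := by
  have hM := natCast_pos_of_symb (s 0)
  have hMb : M * b < 1 := by
    have := hb.2; rw [lt_div_iff₀ hM] at this; linarith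
  have hb0 := hb.1
  refine ⟨hρ, fun n => ?_, fun n => ?_, fun n => ?_, fun n => ?_⟩ <;>
    rcases s n with k | k <;> simp only [rateS, shiftS]
  · linarith
  · exact hb0
  · exact h1
  · exact h0
  · exact le_rfl
  · nlinarith [(Nat.cast_nonneg (k : ℕ) : (0 : ℝ) ≤ (k : ℕ))]
  · nlinarith
  · nlinarith [fin_cast_add_one_le k]

lemma max_rate_lt_one (hM : 2 ≤ M) (ha : a ∈ Ioo 0 (1 / (M : ℝ))) : max a (1 - M * a) < 1 := by
  have hM' : (2 : ℝ) ≤ M := by exact_mod_cast hM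
  have h1 := ha.1
  have h2 := ha.2
  rw [lt_div_iff₀ (by linarith)] at h2
  exact max_lt (by nlinarith) (by nlinarith)

lemma mem_interior_Omega_inl {k : Fin M} {x : ℝ × ℝ × ℝ} :
    x ∈ interior (Omega M a (Sum.inl k)) ↔
      x.1 ∈ Ioo (k * a) ((k + 1) * a) ∧ x.2.1 ∈ Ioo (0 : ℝ) 1 ∧ x.2.2 ∈ Ioo (0 : ℝ) 1 := by
  simp only [Omega, interior_prod_eq, interior_Ico, interior_Icc, mem_prod]

lemma mem_interior_Omega_inr {k : Fin M} {x : ℝ × ℝ × ℝ} :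
    x ∈ interior (Omega M a (Sum.inr k)) ↔
      x.1 ∈ Ioo (M * a) 1 ∧ x.2.1 ∈ Ioo ((k : ℝ) / M) ((k + 1) / M) ∧ x.2.2 ∈ Ioo (0 : ℝ) 1 := by
  have hM := natCast_pos_of_fin k
  simp only [Omega, interior_prod_eq, interior_Icc, mem_prod]
  split_ifs with h
  · have h1 : ((k : ℕ) : ℝ) + 1 = M := by exact_mod_cast h
    rw [interior_Icc, h1, div_self hM.ne', ← h1, add_sub_cancel_right]
  · rw [interior_Ico]

/-- The open unit cube. -/
def openCube : Set (ℝ × ℝ × ℝ) := Ioo 0 1 ×ˢ Ioo 0 1 ×ˢ Ioo 0 1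

/-- The closed unit cube. -/
def closedCube : Set (ℝ × ℝ × ℝ) := Icc 0 1 ×ˢ Icc 0 1 ×ˢ Icc 0 1

lemma openCube_subset_closedCube : openCube ⊆ closedCube :=
  prod_mono Ioo_subset_Icc_self (prod_mono Ioo_subset_Icc_self Ioo_subset_Icc_self)

section Params

variable (ha : a ∈ Ioo 0 (1 / (M : ℝ))) (hb : b ∈ Ioo 0 (1 / (M : ℝ)))
include ha

lemma natCast_pos_of_param : (0 : ℝ) < M := by
  have h := ha.1.trans ha.2
  exact one_div_pos.mp h

lemma natCast_mul_lt_one : M * a < 1 := by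
  have := ha.2
  rw [lt_div_iff₀ (natCast_pos_of_param ha)] at this
  linarith

lemma interior_Omega_subset (γ : Symb M) : interior (Omega M a γ) ⊆ openCube := by
  intro x hx
  have hMa := natCast_mul_lt_one ha
  have hM := natCast_pos_of_param ha
  have ha0 := ha.1
  rcases γ with k | k
  · obtain ⟨h1, h2, h3⟩ := mem_interior_Omega_inl.1 hx
    have hk : (0 : ℝ) ≤ k * a := by positivity
    exact ⟨⟨by linarith [h1.1], by nlinarith [h1.2, fin_cast_add_one_le k]⟩, h2, h3⟩
  · obtain ⟨h1, h2, h3⟩ := mem_interior_Omega_inr.1 hx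
    have hk : (0 : ℝ) ≤ k / M := by positivity
    have hk' : ((k : ℝ) + 1) / M ≤ 1 := (div_le_one hM).2 (fin_cast_add_one_le k)
    exact ⟨⟨by nlinarith [h1.1], h1.2⟩, ⟨by linarith [h2.1], by linarith [h2.2]⟩, h3⟩

lemma Omega_unique {x : ℝ × ℝ × ℝ} {γ γ' : Symb M} (h : x ∈ Omega M a γ)
    (h' : x ∈ Omega M a γ') : γ = γ' := by
  have hM := natCast_pos_of_param ha
  have ha0 := ha.1
  have hJ : ∀ k : Fin M, x.2.1 ∈ (if (k : ℕ) + 1 = M then Icc (((M : ℝ) - 1) / M) 1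
      else Ico ((k : ℝ) / M) (((k : ℝ) + 1) / M)) →
      (k : ℝ) ≤ M * x.2.1 ∧ (M * x.2.1 < k + 1 ∨ (k : ℕ) + 1 = M) := by
    intro k hk
    split_ifs at hk with h
    · refine ⟨?_, Or.inr h⟩
      have h1 : ((k : ℕ) : ℝ) + 1 = M := by exact_mod_cast h
      have := hk.1
      rw [div_le_iff₀ hM] at this
      linarith
    · have h1 := hk.1
      have h2 := hk.2
      rw [div_le_iff₀ hM] at h1
      rw [lt_div_iff₀ hM] at h2
      exact ⟨by linarith, Or.inl (by linarith)⟩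
  have hle : ∀ k k' : Fin M, (k : ℝ) ≤ M * x.2.1 → (M * x.2.1 < k' + 1 ∨ (k' : ℕ) + 1 = M) →
      k ≤ k' := by
    intro k k' h1 h2
    rcases h2 with h2 | h2
    · have : ((k : ℕ) : ℝ) < (k' : ℕ) + 1 := by linarith
      have : (k : ℕ) < k' + 1 := by exact_mod_cast this
      exact Fin.le_def.2 (by omega)
    · exact Fin.le_def.2 (by have := k.2; omega)
  rcases γ with k | k <;> rcases γ' with k' | k' <;> obtain ⟨h1, h2, h3⟩ := h <;>
    obtain ⟨h1', h2', h3'⟩ := h'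
  · have h4 : (k : ℝ) < k' + 1 := lt_of_mul_lt_mul_right (h1.1.trans_lt h1'.2) ha0.le
    have h5 : (k' : ℝ) < k + 1 := lt_of_mul_lt_mul_right (h1'.1.trans_lt h1.2) ha0.le
    have h6 : (k : ℕ) < k' + 1 := by exact_mod_cast h4
    have h7 : (k' : ℕ) < k + 1 := by exact_mod_cast h5
    exact congrArg Sum.inl (Fin.ext (by omega))
  · nlinarith [h1.2, h1'.1, fin_cast_add_one_le k]
  · nlinarith [h1'.2, h1.1, fin_cast_add_one_le k']
  · obtain ⟨h4, h5⟩ := hJ k h2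
    obtain ⟨h4', h5'⟩ := hJ k' h2'
    exact congrArg Sum.inr (le_antisymm (hle _ _ h4 h5') (hle _ _ h4' h5))

lemma baker_eq_branch {x : ℝ × ℝ × ℝ} {γ : Symb M} (h : x ∈ Omega M a γ) :
    baker M a b x = branch M a b γ x := by
  have hex : ∃ γ : Symb M, x ∈ Omega M a γ := ⟨γ, h⟩
  unfold baker
  rw [dif_pos hex, Omega_unique ha hex.choose_spec h]

lemma exists_mem_Omega {x : ℝ × ℝ × ℝ} (hx : x ∈ closedCube) : ∃ γ : Symb M, x ∈ Omega M a γ := by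
  obtain ⟨h1, h2, h3⟩ := hx
  have hM := natCast_pos_of_param ha
  have ha0 := ha.1
  rcases lt_or_ge x.1 (M * a) with h | h
  · have h0 : 0 ≤ x.1 / a := div_nonneg h1.1 ha0.le
    have hk : ⌊x.1 / a⌋₊ < M := by
      rw [Nat.floor_lt h0, div_lt_iff₀ ha0]; exact h
    refine ⟨Sum.inl ⟨_, hk⟩, ⟨?_, ?_⟩, h2, h3⟩
    · exact (le_div_iff₀ ha0).1 (Nat.floor_le h0)
    · exact (div_lt_iff₀ ha0).1 (Nat.lt_floor_add_one (x.1 / a))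
  · have h0 : 0 ≤ M * x.2.1 := mul_nonneg hM.le h2.1
    by_cases hl : x.2.1 < ((M : ℝ) - 1) / M
    · rw [lt_div_iff₀ hM] at hl
      have hk : ⌊M * x.2.1⌋₊ + 1 < M := by
        have h4 := Nat.floor_le h0
        have : ((⌊M * x.2.1⌋₊ : ℕ) : ℝ) + 1 < M := by linarith
        exact_mod_cast this
      refine ⟨Sum.inr ⟨⌊M * x.2.1⌋₊, by omega⟩, ⟨h, h1.2⟩, ?_, h3⟩
      rw [if_neg (by simp only; omega)]
      refine ⟨?_, ?_⟩
      · rw [div_le_iff₀ hM, mul_comm x.2.1]; exact Nat.floor_le h0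
      · rw [lt_div_iff₀ hM, mul_comm x.2.1]; exact Nat.lt_floor_add_one (M * x.2.1)
    · have hM0 : 0 < M := by exact_mod_cast hM
      refine ⟨Sum.inr ⟨M - 1, by omega⟩, ⟨h, h1.2⟩, ?_, h3⟩
      rw [if_pos (by simp only; omega)]
      exact ⟨not_lt.1 hl, h2.2⟩

include hb

lemma branch_mem_closedCube {x : ℝ × ℝ × ℝ} {γ : Symb M} (hx : x ∈ Omega M a γ) :
    branch M a b γ x ∈ closedCube := by
  have hM := natCast_pos_of_param ha
  have hMa := natCast_mul_lt_one ha
  have hMb := natCast_mul_lt_one hb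
  have ha0 := ha.1
  have hb0 := hb.1
  rcases γ with k | k <;> obtain ⟨h1, h2, h3⟩ := hx <;> have hk := fin_cast_add_one_le k <;>
    have hk0 : (0 : ℝ) ≤ k := Nat.cast_nonneg _
  · refine ⟨⟨div_nonneg (by linarith [h1.1]) ha0.le, (div_le_one ha0).2 (by linarith [h1.2])⟩,
      ⟨by have := h2.1; simp only [branch]; positivity, ?_⟩,
      ⟨mul_nonneg (by linarith) h3.1, by simp only [branch]; nlinarith [h3.1, h3.2]⟩⟩
    simp only [branch]
    rw [← add_div, div_le_one hM]
    linarith [h2.2]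
  · have hc : (k : ℝ) ≤ M * x.2.1 ∧ M * x.2.1 ≤ k + 1 := by
      split_ifs at h2 with h
      · have hkM : ((k : ℕ) : ℝ) + 1 = M := by exact_mod_cast h
        have h4 := h2.1
        rw [div_le_iff₀ hM] at h4
        constructor <;> nlinarith [h2.2]
      · have h4 := h2.1
        have h5 := h2.2
        rw [div_le_iff₀ hM] at h4
        rw [lt_div_iff₀ hM] at h5
        constructor <;> linarith
    refine ⟨⟨div_nonneg (by linarith [h1.1]) (by linarith),
      (div_le_one (by linarith)).2 (by linarith [h1.2])⟩,
      ⟨by simp only [branch]; linarith, by simp only [branch]; linarith⟩,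
      ⟨?_, ?_⟩⟩ <;> simp only [branch]
    · nlinarith [h3.1, mul_nonneg hb0.le h3.1, mul_nonneg hb0.le hk0]
    · nlinarith [mul_le_mul_of_nonneg_left h3.2 hb0.le]

lemma baker_mem_closedCube {x : ℝ × ℝ × ℝ} (hx : x ∈ closedCube) :
    baker M a b x ∈ closedCube := by
  obtain ⟨γ, hγ⟩ := exists_mem_Omega ha hx
  rw [baker_eq_branch ha hγ]
  exact branch_mem_closedCube ha hb hγ

lemma iterate_baker_mem_closedCube {x : ℝ × ℝ × ℝ} (hx : x ∈ closedCube) (n : ℕ) :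
    (baker M a b)^[n] x ∈ closedCube := by
  induction n with
  | zero => exact hx
  | succ n ih => rw [Function.iterate_succ_apply']; exact baker_mem_closedCube ha hb ih

/-- The images of the domains `Ω_γ` overlap in boundary points at most: a point in the interior of
some `Ω_γ` is determined by its image. -/
lemma eq_of_baker_eq {x y : ℝ × ℝ × ℝ} {γ : Symb M} (hx : x ∈ interior (Omega M a γ))
    (hy : y ∈ closedCube) (h : baker M a b y = baker M a b x) : y = x := by
  have hM := natCast_pos_of_param ha
  have hMa := natCast_mul_lt_one ha
  have hMb := natCast_mul_lt_one hb
  have ha0 := ha.1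
  have hb0 := hb.1
  obtain ⟨⟨-, -⟩, ⟨hx1, hx2⟩, ⟨hx3, hx4⟩⟩ := interior_Omega_subset ha γ hx
  obtain ⟨γ', hγ'⟩ := exists_mem_Omega ha hy
  obtain ⟨⟨-, -⟩, ⟨hy1, hy2⟩, ⟨hy3, hy4⟩⟩ := hy
  rw [baker_eq_branch ha (interior_subset hx), baker_eq_branch ha hγ'] at h
  clear hx hγ'
  obtain ⟨x1, x2, x3⟩ := x
  obtain ⟨y1, y2, y3⟩ := y
  simp only at hx1 hx2 hx3 hx4 hy1 hy2 hy3 hy4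
  have habs : |y2 - x2| < 1 := abs_lt.2 ⟨by linarith, by linarith⟩
  rcases γ with k | k <;> rcases γ' with k' | k' <;>
    simp only [branch, Prod.mk.injEq] at h <;> obtain ⟨e1, e2, e3⟩ := h
  · rw [← add_div, ← add_div, div_left_inj' hM.ne'] at e2
    obtain rfl := fin_eq_of_abs_sub_lt e2 habs
    rw [div_left_inj' ha0.ne'] at e1
    have h3 : y3 = x3 := mul_left_cancel₀ (by linarith : (1 - M * b) ≠ 0) e3
    exact Prod.ext (by linarith) (Prod.ext (by simp only; linarith) h3)
  · exfalso
    nlinarith [mul_nonneg hb0.le hy3, mul_nonneg hb0.le (Nat.cast_nonneg (k' : ℕ) : (0 : ℝ) ≤ k')]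
  · exfalso
    nlinarith [mul_pos hb0 hx3, mul_nonneg hb0.le (Nat.cast_nonneg (k : ℕ) : (0 : ℝ) ≤ k)]
  · have e4 : y3 + k' = x3 + k := mul_left_cancel₀ hb0.ne' (by linarith)
    obtain rfl := fin_eq_of_abs_sub_lt e4 (abs_lt.2 ⟨by linarith, by linarith⟩)
    rw [div_left_inj' (by linarith)] at e1
    have h2 : y2 = x2 := mul_left_cancel₀ hM.ne' (by linarith)
    exact Prod.ext (by linarith) (Prod.ext h2 (by simp only; linarith))

omit hb in
/-- A point in the interior of `Ω_γ` and its image, written in the directions of contraction. -/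
lemma relations_of_mem_interior {x : ℝ × ℝ × ℝ} {γ : Symb M} (hx : x ∈ interior (Omega M a γ)) :
    x.1 = shiftU M a γ + rateU M a γ * (baker M a b x).1 ∧
      CentralStep M γ x.2.1 (baker M a b x).2.1 ∧
      (baker M a b x).2.2 = shiftS M b γ + rateS M b γ * x.2.2 := by
  have hM := natCast_pos_of_param ha
  have hMa : (1 - M * a) ≠ 0 := by linarith [natCast_mul_lt_one ha]
  have ha0 := ha.1.ne'
  rw [baker_eq_branch ha (interior_subset hx)]
  rcases γ with k | k <;> simp only [branch, rateU, shiftU, rateS, shiftS, CentralStep]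
  · refine ⟨?_, ?_, ?_⟩
    · field_simp; ring
    · rw [add_div]
    · ring
  · refine ⟨?_, ?_, ?_⟩
    · field_simp; ring
    · field_simp; ring
    · ring

omit hb in
lemma mem_interior_of_relations {x y : ℝ × ℝ × ℝ} {γ : Symb M} (hx : x ∈ openCube)
    (hy : y ∈ openCube) (h1 : x.1 = shiftU M a γ + rateU M a γ * y.1)
    (h2 : CentralStep M γ x.2.1 y.2.1) (h3 : y.2.2 = shiftS M b γ + rateS M b γ * x.2.2) :
    x ∈ interior (Omega M a γ) ∧ baker M a b x = y := by
  have hM := natCast_pos_of_param ha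
  have hMa := natCast_mul_lt_one ha
  have ha0 := ha.1
  obtain ⟨⟨hx1, hx1'⟩, ⟨hx2, hx2'⟩, ⟨hx3, hx3'⟩⟩ := hx
  obtain ⟨⟨hy1, hy1'⟩, ⟨hy2, hy2'⟩, ⟨hy3, hy3'⟩⟩ := hy
  have hint : x ∈ interior (Omega M a γ) := by
    rcases γ with k | k <;> simp only [rateU, shiftU, CentralStep] at h1 h2
    · rw [mem_interior_Omega_inl]
      refine ⟨⟨?_, ?_⟩, ⟨hx2, hx2'⟩, ⟨hx3, hx3'⟩⟩ <;> nlinarith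
    · rw [mem_interior_Omega_inr]
      refine ⟨⟨?_, hx1'⟩, ⟨?_, ?_⟩, ⟨hx3, hx3'⟩⟩
      · nlinarith
      · rw [h2]; exact div_lt_div_of_pos_right (by linarith) hM
      · rw [h2]; exact div_lt_div_of_pos_right (by linarith) hM
  refine ⟨hint, ?_⟩
  obtain ⟨g1, g2, g3⟩ := relations_of_mem_interior (b := b) ha hint
  have hr : rateU M a γ ≠ 0 := by
    rcases γ with k | k <;> simp only [rateU]
    · exact ha0.ne'
    · linarith
  refine Prod.ext ?_ (Prod.ext ?_ (g3.trans h3.symm))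
  · exact mul_left_cancel₀ hr (by linarith)
  · rcases γ with k | k <;> simp only [CentralStep] at h2 g2
    · exact g2.trans h2.symm
    · have := g2.symm.trans h2
      rw [div_left_inj' hM.ne'] at this
      linarith

/-- Every point of the fibre lies on a two-sided orbit that passes through the interior of
`Ω_{ω_n}` at time `n`, although the fibre asks only for a separate preimage for each `n < 0`. -/
lemma exists_orbit_of_mem_codingFibre {ω : ℤ → Symb M} {x : ℝ × ℝ × ℝ}
    (hx : x ∈ codingFibre M a b ω) :
    ∃ z : ℤ → ℝ × ℝ × ℝ, z 0 = x ∧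
      ∀ n, z n ∈ interior (Omega M a (ω n)) ∧ baker M a b (z n) = z (n + 1) := by
  have hx' : ∀ n : ℤ, x ∈ preIter (baker M a b) n (interior (Omega M a (ω n))) :=
    fun n => mem_iInter.1 hx n
  have hpast : ∀ m : ℕ, ∃ y ∈ interior (Omega M a (ω (-m))), (baker M a b)^[m] y = x := by
    intro m
    cases m with
    | zero => exact ⟨x, hx' 0, rfl⟩
    | succ m => exact hx' (Int.negSucc m)
  choose y hyint hy using hpast
  have hcube : ∀ m, y m ∈ closedCube := fun m =>
    openCube_subset_closedCube (interior_Omega_subset ha _ (hyint m))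
  have hstep : ∀ m, baker M a b (y (m + 1)) = y m := by
    intro m
    induction m using Nat.strong_induction_on with
    | _ m ih =>
      have key : ∀ j ≤ m, (baker M a b)^[m - j] (baker M a b (y (m + 1))) = y j := by
        intro j
        induction j with
        | zero =>
          intro _
          rw [Nat.sub_zero, ← Function.iterate_succ_apply, hy]
          exact (hy 0).symm
        | succ j ihj =>
          intro hj
          refine eq_of_baker_eq ha hb (hyint (j + 1))
            (iterate_baker_mem_closedCube ha hb (baker_mem_closedCube ha hb (hcube _)) _) ?_
          rw [ih j (by omega), ← Function.iterate_succ_apply' (baker M a b), ← ihj (by omega)]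
          congr 2
          omega
      simpa using key m le_rfl
  have hy0 : y 0 = x := hy 0
  refine ⟨fun n => match n with
    | Int.ofNat n => (baker M a b)^[n] x
    | Int.negSucc m => y (m + 1), rfl, fun n => ?_⟩
  cases n with
  | ofNat n => exact ⟨hx' n, (Function.iterate_succ_apply' _ n x).symm⟩
  | negSucc m =>
    refine ⟨hyint (m + 1), ?_⟩
    cases m with
    | zero => exact (hstep 0).trans hy0
    | succ m => exact hstep (m + 1)

omit ha hb in
lemma mem_codingFibre_of_orbit {ω : ℤ → Symb M} {z : ℤ → ℝ × ℝ × ℝ}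
    (hz : ∀ n, z n ∈ interior (Omega M a (ω n)) ∧ baker M a b (z n) = z (n + 1)) :
    z 0 ∈ codingFibre M a b ω := by
  have hit : ∀ (n : ℕ) (m : ℤ), (baker M a b)^[n] (z m) = z (m + n) := by
    intro n
    induction n with
    | zero => intro m; simp
    | succ n ih =>
      intro m
      rw [Function.iterate_succ_apply', ih, (hz _).2]
      congr 1
      push_cast
      ring
  refine mem_iInter.2 fun n => ?_
  cases n with
  | ofNat n =>
    change (baker M a b)^[n] (z 0) ∈ interior (Omega M a (ω n))
    rw [hit]
    simpa using (hz n).1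
  | negSucc m =>
    refine ⟨z (Int.negSucc m), (hz _).1, ?_⟩
    rw [hit]
    congr 1
    rw [Int.negSucc_eq]
    push_cast
    ring

lemma eq_of_mem_codingFibre (hM : 2 ≤ M) {ω : ℤ → Symb M} {C : ℝ} (hω : IsRegular ω C)
    {x : ℝ × ℝ × ℝ} (hx : x ∈ codingFibre M a b ω) :
    x = (coordU M a ω 0, C, coordS M b ω 0) := by
  obtain ⟨z, hz0, hz⟩ := exists_orbit_of_mem_codingFibre ha hb hx
  have hrel := fun n => relations_of_mem_interior (b := b) ha (hz n).1
  have hopen := fun n => interior_Omega_subset ha _ (hz n).1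
  have hcube := fun n => openCube_subset_closedCube (hopen n)
  simp only [(hz _).2] at hrel
  refine Prod.ext ?_ (Prod.ext ?_ ?_) <;> rw [← hz0]
  · refine (isContracting_u ha (le_max_left _ _) (le_max_right _ _) (max_rate_lt_one hM ha)
      (fun i : ℕ => ω (0 + i))).eq_affineSeries (v := fun i : ℕ => (z (i : ℤ)).1)
      (fun n => (hcube n).1) (fun n => ?_)
    simpa using (hrel n).1
  · exact hω.central_unique (fun n => (z n).2.1) fun n => ⟨(hopen n).2.1, (hrel n).2.1⟩
  · have := (isContracting_s hb (le_max_left _ _) (le_max_right _ _) (max_rate_lt_one hM hb)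
      (fun i : ℕ => ω (0 - 1 - i))).eq_affineSeries (v := fun i : ℕ => (z (-i : ℤ)).2.2)
      (fun n => (hcube _).2.2) (fun n => ?_)
    · simpa [coordS] using this
    · have h1 := (hrel (0 - 1 - n)).2.2
      rw [show (0 - 1 - n + 1 : ℤ) = -n by ring] at h1
      simp only [h1]
      rw [show (-((n + 1 : ℕ) : ℤ)) = 0 - 1 - n by push_cast; ring]

lemma coord_mem_codingFibre (hM : 2 ≤ M) {ω : ℤ → Symb M} {C : ℝ} (hω : IsRegular ω C) :
    (coordU M a ω 0, C, coordS M b ω 0) ∈ codingFibre M a b ω ∩ openCube := by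
  obtain ⟨c, hc⟩ := hω.exists_central
  have hMa := natCast_mul_lt_one ha
  have hMb := natCast_mul_lt_one hb
  have hM0 := natCast_pos_of_param ha
  have ha0 := ha.1
  have hb0 := hb.1
  have hu := fun n : ℤ => isContracting_u ha (le_max_left _ _) (le_max_right _ _)
    (max_rate_lt_one hM ha) (fun i : ℕ => ω (n + i))
  have hs := fun n : ℤ => isContracting_s hb (le_max_left _ _) (le_max_right _ _)
    (max_rate_lt_one hM hb) (fun i : ℕ => ω (n - 1 - i))
  have hopen : ∀ n : ℤ, (coordU M a ω n, c n, coordS M b ω n) ∈ openCube := by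
    refine fun n => ⟨(hu n).affineSeries_mem_Ioo ?_ ?_, (hc n).1,
      (hs n).affineSeries_mem_Ioo ?_ ?_⟩
    · obtain ⟨i, hi⟩ := hω.right_future n
      obtain ⟨k, hk⟩ := Sum.isRight_iff.1 hi
      exact ⟨i, by simp only [hk, shiftU]; positivity⟩
    · obtain ⟨i, hi⟩ := hω.left_future n
      obtain ⟨k, hk⟩ := Sum.isLeft_iff.1 hi
      exact ⟨i, by simp only [hk, shiftU, rateU]; nlinarith [fin_cast_add_one_le k]⟩
    · obtain ⟨i, hi⟩ := hω.right_past n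
      obtain ⟨k, hk⟩ := Sum.isRight_iff.1 hi
      refine ⟨i, ?_⟩
      simp only [hk, shiftS]
      nlinarith [(Nat.cast_nonneg (k : ℕ) : (0 : ℝ) ≤ (k : ℕ))]
    · obtain ⟨i, hi⟩ := hω.left_past n
      obtain ⟨k, hk⟩ := Sum.isLeft_iff.1 hi
      exact ⟨i, by simp only [hk, shiftS, rateS]; nlinarith⟩
  have h := mem_codingFibre_of_orbit (a := a) (b := b) (ω := ω)
    (z := fun n => (coordU M a ω n, c n, coordS M b ω n)) fun n => by
      refine mem_interior_of_relations ha (hopen n) (hopen (n + 1)) ?_ (hc n).2 ?_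
      · have := (hu n).affineSeries_eq
        simp only [Nat.cast_zero, add_zero, Nat.cast_add, Nat.cast_one] at this
        simp only [coordU, this, add_assoc, add_comm (1 : ℤ)]
      · have := (hs (n + 1)).affineSeries_eq
        simp only [Nat.cast_zero, add_sub_cancel_right, sub_zero, Nat.cast_add, Nat.cast_one]
          at this
        simp only [coordS, add_sub_cancel_right, this, sub_sub, add_comm (1 : ℤ)]
  have h0 := hopen 0
  rw [← hω.central_unique c hc]
  exact ⟨h, h0⟩

/-- For a regular code the fibre is a single point, with coordinates given by convergent series. -/
lemma toReal_decode (hM : 2 ≤ M) {ω : ℤ → Symb M} {C : ℝ} (hω : IsRegular ω C) :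
    (decode M a b ω).toReal = (coordU M a ω 0, C, coordS M b ω 0) := by
  obtain ⟨h, h1, h2, h3⟩ := coord_mem_codingFibre ha hb hM hω
  have hex : ∃ x : Cube, x.toReal ∈ codingFibre M a b ω :=
    ⟨(⟨_, Ioo_subset_Icc_self h1⟩, ⟨_, Ioo_subset_Icc_self h2⟩, ⟨_, Ioo_subset_Icc_self h3⟩), h⟩
  unfold decode
  rw [dif_pos hex]
  exact eq_of_mem_codingFibre ha hb hM hω hex.choose_spec

end Params

end Fibre

/-! ### Heights and the bracket stack -/

section Height

variable {A B : Type}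

lemma height_zero (ζ : ℤ → A ⊕ B) : height ζ 0 = 0 := by simp [height]

lemma height_add_one (ζ : ℤ → A ⊕ B) (i : ℤ) :
    height ζ (i + 1) = height ζ i + bracketSign (ζ i) := by
  unfold height
  rcases le_or_gt 0 i with h | h
  · rw [show Finset.Ico 0 (i + 1) = insert i (Finset.Ico 0 i) by ext; simp; omega,
      Finset.sum_insert (by simp), Finset.Ico_eq_empty (by omega : ¬ i + 1 < 0),
      Finset.Ico_eq_empty (by omega : ¬ i < 0)]
    ring
  · rw [show Finset.Ico i 0 = insert i (Finset.Ico (i + 1) 0) by ext; simp; omega,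
      Finset.sum_insert (by simp), Finset.Ico_eq_empty (by omega : ¬ 0 < i + 1),
      Finset.Ico_eq_empty (by omega : ¬ 0 < i)]
    ring

lemma height_congr {A' B' : Type} {ζ : ℤ → A ⊕ B} {ζ' : ℤ → A' ⊕ B'}
    (h : ∀ i, bracketSign (ζ i) = bracketSign (ζ' i)) : height ζ = height ζ' := by
  funext i
  simp only [height, h]

lemma eq_height {ζ : ℤ → A ⊕ B} {g : ℤ → ℤ} (h0 : g 0 = 0)
    (h : ∀ i, g (i + 1) = g i + bracketSign (ζ i)) : g = height ζ := by
  funext i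
  induction i using Int.induction_on with
  | zero => rw [h0, height_zero]
  | succ i ih => rw [h, height_add_one, ih]
  | pred i ih =>
    have h1 := h (-i - 1)
    have h2 := height_add_one ζ (-i - 1)
    rw [sub_add_cancel] at h1 h2
    linarith

lemma bracketSign_le_one : ∀ x : A ⊕ B, bracketSign x ≤ 1
  | Sum.inl _ => le_rfl
  | Sum.inr _ => by simp [bracketSign]

/-- Heights grow by at most one at a time, so that they skip no value on their way up. -/
lemma exists_height_eq (ζ : ℤ → A ⊕ B) {s n h : ℤ} (hsn : s ≤ n) (hs : height ζ s ≤ h)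
    (hn : h ≤ height ζ n) : ∃ t, s ≤ t ∧ t ≤ n ∧ height ζ t = h := by
  induction n, hsn using Int.leInduction with
  | base => exact ⟨s, le_rfl, le_rfl, le_antisymm hs hn⟩
  | succ n hsn ih =>
    rcases le_or_gt h (height ζ n) with h1 | h1
    · obtain ⟨t, h2, h3, h4⟩ := ih h1
      exact ⟨t, h2, by omega, h4⟩
    · refine ⟨n + 1, by omega, le_rfl, le_antisymm ?_ hn⟩
      have := bracketSign_le_one (ζ n)
      rw [height_add_one]
      omega

/-- The heights are unbounded below in the past: infinitely many brackets are open at any time. -/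
def UnboundedPast (ζ : ℤ → A ⊕ B) : Prop := ∀ h n : ℤ, ∃ t < n, height ζ t ≤ h

/-- The position of the bracket number `m` (counted from the innermost, `m = 0`) among the left
brackets before `n` that are still open at time `n`. -/
noncomputable def stackPos (ζ : ℤ → A ⊕ B) (n : ℤ) (m : ℕ) : ℤ :=
  sSup {t : ℤ | t < n ∧ height ζ t = height ζ n - (m + 1)}

lemma stackPos_congr {A' B' : Type} {ζ : ℤ → A ⊕ B} {ζ' : ℤ → A' ⊕ B'}
    (h : height ζ = height ζ') : stackPos ζ = stackPos ζ' := by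
  funext n m
  simp only [stackPos, h]

lemma isGreatest_stackPos {ζ : ℤ → A ⊕ B} (h : UnboundedPast ζ) (n : ℤ) (m : ℕ) :
    IsGreatest {t : ℤ | t < n ∧ height ζ t = height ζ n - (m + 1)} (stackPos ζ n m) := by
  have hb : BddAbove {t : ℤ | t < n ∧ height ζ t = height ζ n - (m + 1)} :=
    ⟨n, fun t ht => ht.1.le⟩
  refine ⟨Int.csSup_mem ?_ hb, fun t ht => le_csSup hb ht⟩
  obtain ⟨s, hs, hs'⟩ := h (height ζ n - (m + 1)) n
  obtain ⟨t, -, h2, h3⟩ := exists_height_eq ζ hs.le hs' (by omega)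
  refine ⟨t, lt_of_le_of_ne h2 ?_, h3⟩
  rintro rfl
  omega

lemma isLeft_stackPos {ζ : ℤ → A ⊕ B} (h : UnboundedPast ζ) (n : ℤ) (m : ℕ) :
    (ζ (stackPos ζ n m)).isLeft := by
  obtain ⟨⟨h1, h2⟩, h3⟩ := isGreatest_stackPos h n m
  by_contra hl
  rw [Sum.not_isLeft, Sum.isRight_iff] at hl
  obtain ⟨b, hb⟩ := hl
  have h4 := height_add_one ζ (stackPos ζ n m)
  rw [hb, bracketSign] at h4
  obtain ⟨t, h5, h6, h7⟩ := exists_height_eq ζ (s := stackPos ζ n m + 1) (n := n)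
    (h := height ζ n - (m + 1)) (by omega) (by omega) (by omega)
  have htn : t ≠ n := by rintro rfl; omega
  have := h3 ⟨lt_of_le_of_ne h6 htn, h7⟩
  omega

lemma stackPos_injective {ζ : ℤ → A ⊕ B} (h : UnboundedPast ζ) (n : ℤ) :
    Function.Injective (stackPos ζ n) := by
  intro m m' hm
  have h1 := (isGreatest_stackPos h n m).1.2
  have h2 := (isGreatest_stackPos h n m').1.2
  rw [hm] at h1
  omega

/-- A left bracket is put on top of the stack. -/
lemma stackPos_add_one_zero_of_inl {ζ : ℤ → A ⊕ B} {n : ℤ} {k : A} (h : ζ n = Sum.inl k) :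
    stackPos ζ (n + 1) 0 = n := by
  have h1 := height_add_one ζ n
  rw [h, bracketSign] at h1
  refine IsGreatest.csSup_eq ⟨⟨by omega, ?_⟩, fun t ht => by have := ht.1; omega⟩
  push_cast
  omega

lemma stackPos_add_one_succ_of_inl {ζ : ℤ → A ⊕ B} {n : ℤ} {k : A} (h : ζ n = Sum.inl k) (m : ℕ) :
    stackPos ζ (n + 1) (m + 1) = stackPos ζ n m := by
  have h1 := height_add_one ζ n
  rw [h, bracketSign] at h1
  unfold stackPos
  congr 1
  ext t
  simp only [mem_ofPred_eq]
  push_cast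
  constructor
  · rintro ⟨h2, h3⟩
    have : t ≠ n := by rintro rfl; omega
    omega
  · omega

/-- A right bracket removes the top of the stack. -/
lemma stackPos_add_one_of_inr {ζ : ℤ → A ⊕ B} {n : ℤ} {k : B} (h : ζ n = Sum.inr k) (m : ℕ) :
    stackPos ζ (n + 1) m = stackPos ζ n (m + 1) := by
  have h1 := height_add_one ζ n
  rw [h, bracketSign] at h1
  unfold stackPos
  congr 1
  ext t
  simp only [mem_ofPred_eq]
  push_cast
  constructor
  · rintro ⟨h2, h3⟩
    have : t ≠ n := by rintro rfl; omega
    omega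
  · omega

/-- The left bracket that a right bracket closes is the top of the stack. -/
lemma matchLeft_eq_stackPos {ζ : ℤ → A ⊕ B} {n : ℤ} {k : B} (h : ζ n = Sum.inr k) :
    matchLeft ζ n = stackPos ζ n 0 := by
  have h1 := height_add_one ζ n
  rw [h, bracketSign] at h1
  unfold stackPos matchLeft
  congr 1
  ext t
  simp only [mem_ofPred_eq]
  push_cast
  constructor
  · rintro ⟨h2, h3⟩
    have : t ≠ n := by rintro rfl; omega
    omega
  · omega

end Height

/-! ### The central coordinate -/

section Central

variable {M : ℕ} {B : Type}

/-- The difference of two central orbits with the same code is divided by `M` at left brackets and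
multiplied by `M` at right brackets, so its product with `M` to the height is constant. -/
lemma IsCentralOrbit.sub_mul_zpow_eq {ω : ℤ → Symb M} {c c' : ℤ → ℝ} (hc : IsCentralOrbit ω c)
    (hc' : IsCentralOrbit ω c') (n : ℤ) :
    (c n - c' n) * (M : ℝ) ^ height ω n = c 0 - c' 0 := by
  have hM := natCast_pos_of_symb (ω 0)
  have hstep : ∀ n, (c (n + 1) - c' (n + 1)) * (M : ℝ) ^ height ω (n + 1) =
      (c n - c' n) * (M : ℝ) ^ height ω n := by
    intro n
    have h1 := (hc n).2
    have h2 := (hc' n).2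
    rw [height_add_one, zpow_add₀ hM.ne']
    rcases h : ω n with k | k <;> rw [h] at h1 h2 <;> simp only [CentralStep] at h1 h2
    · rw [h1, h2, bracketSign, zpow_one]
      field_simp
      ring
    · rw [h1, h2, bracketSign, zpow_neg_one]
      field_simp
      ring
  induction n using Int.induction_on with
  | zero => simp [height_zero]
  | succ n ih => rw [hstep, ih]
  | pred n ih =>
    rw [← hstep, sub_add_cancel, ih]

lemma IsCentralOrbit.eq_of_unboundedPast (hM : 2 ≤ M) {ω : ℤ → Symb M} (hω : UnboundedPast ω)
    {c c' : ℤ → ℝ} (hc : IsCentralOrbit ω c) (hc' : IsCentralOrbit ω c') : c 0 = c' 0 := by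
  have hM1 : (1 : ℝ) < M := by exact_mod_cast hM
  by_contra hne
  have hpos : 0 < |c 0 - c' 0| := abs_pos.2 (sub_ne_zero.2 hne)
  obtain ⟨N, hN⟩ := exists_pow_lt_of_lt_one hpos (inv_lt_one_of_one_lt₀ hM1)
  obtain ⟨t, -, ht⟩ := hω (-N) 0
  have h1 := hc.sub_mul_zpow_eq hc' t
  have h2 : |c t - c' t| ≤ 1 := by
    rw [abs_le]
    constructor <;> linarith [(hc t).1.1, (hc t).1.2, (hc' t).1.1, (hc' t).1.2]
  have h3 : (M : ℝ) ^ height ω t ≤ (M : ℝ)⁻¹ ^ N := by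
    rw [inv_pow, ← zpow_natCast, ← zpow_neg]
    exact zpow_le_zpow_right₀ hM1.le ht
  rw [← h1, abs_mul, abs_of_pos (zpow_pos (by linarith : (0 : ℝ) < M) _)] at hN
  nlinarith [zpow_pos (by linarith : (0 : ℝ) < M) (height ω t)]

variable [NeZero M]

/-- The index of a left bracket, and `0` for right brackets. -/
def leftLabel : Fin M ⊕ B → Fin M
  | Sum.inl k => k
  | Sum.inr _ => 0

/-- The indices of the left brackets that are open at time `n`, from the innermost. -/
noncomputable def stackDigit (ζ : ℤ → Fin M ⊕ B) (n : ℤ) (m : ℕ) : Fin M :=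
  leftLabel (ζ (stackPos ζ n m))

/-- The number in `[0,1]` whose `M`-ary digits are the indices on the stack at time `n`. -/
noncomputable def centralCoord (ζ : ℤ → Fin M ⊕ B) (n : ℤ) : ℝ :=
  affineSeries (fun _ => 1 / (M : ℝ)) (fun m => (stackDigit ζ n m : ℝ) / M)

omit [NeZero M] in
lemma isContracting_digits (hM : 2 ≤ M) (d : ℕ → Fin M) :
    IsContracting (1 / (M : ℝ)) (fun _ => 1 / (M : ℝ)) (fun m => (d m : ℝ) / M) := by
  have hM1 : (1 : ℝ) < M := by exact_mod_cast hM
  have hM0 : (0 : ℝ) < M := by linarith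
  refine ⟨(div_lt_one hM0).2 hM1, fun _ => by positivity, fun _ => le_rfl, fun _ => by positivity,
    fun m => ?_⟩
  rw [← add_div, div_le_one hM0]
  linarith [fin_cast_add_one_le (d m)]

lemma psiAlpha_of_inl {ζ : ℤ → SymbAlpha M} {i : ℤ} {k : Fin M} (h : ζ i = Sum.inl k) :
    psiAlpha M ζ i = Sum.inl k := by
  simp only [psiAlpha, h]

lemma psiAlpha_of_inr {ζ : ℤ → SymbAlpha M} {i : ℤ} {u : Unit} (h : ζ i = Sum.inr u) :
    psiAlpha M ζ i = Sum.inr (leftLabel (ζ (matchLeft ζ i))) := by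
  simp only [psiAlpha, h]
  cases ζ (matchLeft ζ i) <;> rfl

lemma leftLabel_psiAlpha (ζ : ℤ → SymbAlpha M) (i : ℤ) :
    leftLabel (psiAlpha M ζ i) = leftLabel (ζ i) := by
  rcases h : ζ i with k | u
  · rw [psiAlpha_of_inl h]; rfl
  · rw [psiAlpha_of_inr h]; rfl

lemma isLeft_psiAlpha (ζ : ℤ → SymbAlpha M) (i : ℤ) :
    (psiAlpha M ζ i).isLeft = (ζ i).isLeft := by
  rcases h : ζ i with k | u
  · rw [psiAlpha_of_inl h]; rfl
  · rw [psiAlpha_of_inr h]; rfl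

lemma isRight_psiAlpha (ζ : ℤ → SymbAlpha M) (i : ℤ) :
    (psiAlpha M ζ i).isRight = (ζ i).isRight := by
  rcases h : ζ i with k | u
  · rw [psiAlpha_of_inl h]; rfl
  · rw [psiAlpha_of_inr h]; rfl

lemma height_psiAlpha (ζ : ℤ → SymbAlpha M) : height (psiAlpha M ζ) = height ζ := by
  refine height_congr fun i => ?_
  rcases h : ζ i with k | u
  · rw [psiAlpha_of_inl h]; rfl
  · rw [psiAlpha_of_inr h]; rfl

lemma centralCoord_psiAlpha (ζ : ℤ → SymbAlpha M) :
    centralCoord (psiAlpha M ζ) = centralCoord ζ := by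
  funext n
  simp only [centralCoord, stackDigit, leftLabel_psiAlpha, stackPos_congr (height_psiAlpha ζ)]

/-- A left bracket `α_k` prepends the digit `k` to the central coordinate, and the right bracket
that closes it deletes this digit again. -/
lemma centralStep_centralCoord (hM : 2 ≤ M) (ζ : ℤ → SymbAlpha M) (n : ℤ) :
    CentralStep M (psiAlpha M ζ n) (centralCoord ζ n) (centralCoord ζ (n + 1)) := by
  rcases h : ζ n with k | u
  · rw [psiAlpha_of_inl h, CentralStep, centralCoord,
      (isContracting_digits hM _).affineSeries_eq]
    simp only [stackDigit, stackPos_add_one_zero_of_inl h, stackPos_add_one_succ_of_inl h,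
      centralCoord]
    simp only [h, leftLabel]
    ring
  · rw [psiAlpha_of_inr h, CentralStep, centralCoord,
      (isContracting_digits hM _).affineSeries_eq, matchLeft_eq_stackPos h]
    simp only [stackDigit, stackPos_add_one_of_inr h, centralCoord]
    ring

lemma centralCoord_mem_Ioo (hM : 2 ≤ M) {ζ : ℤ → SymbAlpha M} {n : ℤ}
    (h : ∀ k : Fin M, ∃ m, stackDigit ζ n m = k) : centralCoord ζ n ∈ Ioo (0 : ℝ) 1 := by
  have hM0 : (0 : ℝ) < M := by
    have : (2 : ℝ) ≤ M := by exact_mod_cast hM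
    linarith
  refine (isContracting_digits hM _).affineSeries_mem_Ioo ?_ ?_
  · obtain ⟨m, hm⟩ := h ⟨1, hM⟩
    exact ⟨m, by simp only [hm]; positivity⟩
  · obtain ⟨m, hm⟩ := h ⟨0, by omega⟩
    refine ⟨m, ?_⟩
    simp only [hm, Nat.cast_zero, zero_div, add_zero]
    rw [div_lt_one hM0]
    exact_mod_cast hM

lemma isCentralOrbit_psiAlpha (hM : 2 ≤ M) {ζ : ℤ → SymbAlpha M}
    (h : ∀ n, ∀ k : Fin M, ∃ m, stackDigit ζ n m = k) :
    IsCentralOrbit (psiAlpha M ζ) (centralCoord (psiAlpha M ζ)) := by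
  rw [centralCoord_psiAlpha]
  exact fun n => ⟨centralCoord_mem_Ioo hM (h n), centralStep_centralCoord hM ζ n⟩

/-- The codes with infinitely many brackets of both kinds on either side and infinitely many open
brackets at all times, for which the numbers read off the stack form a central orbit. -/
def stackCodes (M : ℕ) [NeZero M] : Set (ℤ → Symb M) :=
  {ω | UnboundedPast ω ∧ IsCentralOrbit ω (centralCoord ω) ∧
    (∀ n : ℤ, ∃ i : ℕ, (ω (n + i)).isLeft) ∧ (∀ n : ℤ, ∃ i : ℕ, (ω (n + i)).isRight) ∧
    (∀ n : ℤ, ∃ i : ℕ, (ω (n - 1 - i)).isLeft) ∧ ∀ n : ℤ, ∃ i : ℕ, (ω (n - 1 - i)).isRight}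

lemma isRegular_of_mem_stackCodes (hM : 2 ≤ M) {ω : ℤ → Symb M} (h : ω ∈ stackCodes M) :
    IsRegular ω (centralCoord ω 0) := by
  obtain ⟨hp, hc, h1, h2, h3, h4⟩ := h
  exact ⟨h1, h2, h3, h4, ⟨_, hc⟩, fun c' hc' => hc'.eq_of_unboundedPast hM hp hc⟩

end Central

/-! ### Time reversal -/

section Flip

variable {A B : Type}

/-- Time reversal: a bracket sequence read from right to left, with left and right brackets
exchanged. -/
def flip (ζ : ℤ → A ⊕ B) (i : ℤ) : B ⊕ A := (ζ (-1 - i)).swap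

lemma flip_flip (ζ : ℤ → A ⊕ B) : flip (flip ζ) = ζ := by
  funext i
  simp only [flip, Sum.swap_swap]
  congr 1
  ring

lemma height_flip (ζ : ℤ → A ⊕ B) (i : ℤ) : height (flip ζ) i = height ζ (-i) := by
  have : (fun i => height ζ (-i)) = height (flip ζ) := by
    refine eq_height (by simp [height_zero]) fun i => ?_
    have h := height_add_one ζ (-1 - i)
    rw [show -1 - i + 1 = -i by ring] at h
    rw [show -(i + 1) = -1 - i by ring, h, flip]
    cases ζ (-1 - i) <;> simp [bracketSign]
  rw [← this]

/-- Time reversal exchanges the two ways of matching brackets. There is no condition that the bracket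
at `i` be matched, as the supremum and the infimum of the empty set of integers have the default
value `0`. -/
lemma matchLeft_flip (ζ : ℤ → A ⊕ B) (i : ℤ) :
    matchLeft (flip ζ) (-1 - i) = -1 - matchRight ζ i := by
  unfold matchLeft matchRight
  simp only [height_flip, show -1 - i + 1 = -i by ring, neg_neg]
  have hb : BddBelow {j : ℤ | i < j ∧ height ζ j = height ζ i} := ⟨i, fun j hj => hj.1.le⟩
  rcases {j : ℤ | i < j ∧ height ζ j = height ζ i}.eq_empty_or_nonempty with h | h
  · have h' : {j : ℤ | j < -i ∧ height ζ (-j) = height ζ i} = ∅ := by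
      rw [eq_empty_iff_forall_notMem] at h ⊢
      rintro j ⟨h1, h2⟩
      exact h (-j) ⟨by omega, h2⟩
    rw [h, h', Int.csSup_empty, Int.csInf_empty]
    ring
  · have hg : IsGreatest {j : ℤ | j < -i ∧ height ζ (-j) = height ζ i}
        (-sInf {j : ℤ | i < j ∧ height ζ j = height ζ i}) := by
      have hmem := Int.csInf_mem h hb
      refine ⟨⟨by have := hmem.1; omega, by rw [neg_neg]; exact hmem.2⟩, ?_⟩
      rintro j ⟨h1, h2⟩
      have := csInf_le hb (show -j ∈ _ from ⟨by omega, h2⟩)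
      omega
    rw [hg.csSup_eq]
    ring

lemma psiBeta_eq_flip {M : ℕ} [NeZero M] (ζ : ℤ → SymbBeta M) :
    psiBeta M ζ = flip (psiAlpha M (flip ζ)) := by
  funext i
  have h1 : flip ζ (-1 - i) = (ζ i).swap := by
    rw [flip]; congr 2; ring
  have h2 : flip ζ (-1 - matchRight ζ i) = (ζ (matchRight ζ i)).swap := by
    rw [flip]; congr 2; ring
  simp only [psiBeta, flip, psiAlpha]
  change _ = Sum.swap (match flip ζ (-1 - i) with
    | Sum.inl k => Sum.inl k
    | Sum.inr _ => match flip ζ (matchLeft (flip ζ) (-1 - i)) with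
      | Sum.inl k => Sum.inr k
      | Sum.inr _ => Sum.inr 0)
  rw [matchLeft_flip, h1, h2]
  cases ζ i <;> cases ζ (matchRight ζ i) <;> rfl

lemma IsCentralOrbit.flip {M : ℕ} {ω : ℤ → Symb M} {c : ℤ → ℝ} (h : IsCentralOrbit ω c) :
    IsCentralOrbit (flip ω) fun n => c (-n) := by
  refine fun n => ⟨(h _).1, ?_⟩
  have h1 := (h (-1 - n)).2
  rw [show -1 - n + 1 = -n by ring] at h1
  simp only [show -(n + 1) = -1 - n by ring, HeterochaosBaker.flip]
  cases hω : ω (-1 - n) <;> rw [hω] at h1 <;> exact h1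

lemma IsRegular.flip {M : ℕ} {ω : ℤ → Symb M} {C : ℝ} (h : IsRegular ω C) :
    IsRegular (flip ω) C := by
  have e1 : ∀ (n : ℤ) (i : ℕ), -1 - (n + i) = (-n) - 1 - i := fun n i => by ring
  have e2 : ∀ (n : ℤ) (i : ℕ), -1 - (n - 1 - i) = -n + i := fun n i => by ring
  refine ⟨fun n => ?_, fun n => ?_, fun n => ?_, fun n => ?_, ?_, fun c hc => ?_⟩
  · simpa only [HeterochaosBaker.flip, Sum.isLeft_swap, e1] using h.right_past (-n)
  · simpa only [HeterochaosBaker.flip, Sum.isRight_swap, e1] using h.left_past (-n)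
  · simpa only [HeterochaosBaker.flip, Sum.isLeft_swap, e2] using h.right_future (-n)
  · simpa only [HeterochaosBaker.flip, Sum.isRight_swap, e2] using h.left_future (-n)
  · exact h.exists_central.imp' (fun c n => c (-n)) fun c hc => hc.flip
  · have := h.central_unique _ (flip_flip ω ▸ hc.flip)
    simpa using this

end Flip

open ENNReal

/-! ### Measurability of the codes -/

section Measurability

instance instDiscreteMeasurableSpaceSum {A B : Type} [MeasurableSpace A] [MeasurableSpace B]
    [DiscreteMeasurableSpace A] [DiscreteMeasurableSpace B] : DiscreteMeasurableSpace (A ⊕ B) :=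
  ⟨fun _ => measurableSet_sum_iff.2 ⟨.of_discrete, .of_discrete⟩⟩

lemma measurable_apply_index {Ω A : Type*} [MeasurableSpace Ω] [MeasurableSpace A]
    {x : Ω → ℤ → A} {g : Ω → ℤ} (hx : Measurable x) (hg : Measurable g) :
    Measurable fun ω => x ω (g ω) :=
  (measurable_from_prod_countable_right (f := fun p : ℤ × (ℤ → A) => p.2 p.1)
    fun i => measurable_pi_apply i).comp (hg.prodMk hx)

lemma measurable_comp_countable₂ {Ω A B C : Type*} [MeasurableSpace Ω] [MeasurableSpace A]
    [MeasurableSpace B] [MeasurableSpace C] [Countable A] [Countable B]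
    [MeasurableSingletonClass A] [MeasurableSingletonClass B] (F : A → B → C) {f : Ω → A}
    {g : Ω → B} (hf : Measurable f) (hg : Measurable g) : Measurable fun ω => F (f ω) (g ω) :=
  (measurable_of_countable fun q : A × B => F q.1 q.2).comp (hf.prodMk hg)

/-- The supremum of a random set of integers is a random variable, including the default value `0`
for sets without a greatest element. -/
lemma measurable_sSup_int {Ω : Type*} [MeasurableSpace Ω] {S : Ω → Set ℤ}
    (hS : ∀ j, MeasurableSet {ω | j ∈ S ω}) : Measurable fun ω => sSup (S ω) := by
  have hg : ∀ j, MeasurableSet {ω | IsGreatest (S ω) j} := by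
    intro j
    have : {ω | IsGreatest (S ω) j} = {ω | j ∈ S ω} ∩ ⋂ i : ℤ, {ω | i ∈ S ω → i ≤ j} := by
      ext ω
      simp [IsGreatest, upperBounds]
    rw [this]
    refine (hS j).inter (MeasurableSet.iInter fun i => ?_)
    by_cases hij : i ≤ j
    · simp [hij]
    · simp only [hij, imp_false]
      exact (hS i).compl
  refine measurable_to_countable' fun j => ?_
  have : (fun ω => sSup (S ω)) ⁻¹' {j} =
      {ω | IsGreatest (S ω) j} ∪ ((⋃ i : ℤ, {ω | IsGreatest (S ω) i})ᶜ ∩ {_ω | (0 : ℤ) = j}) := by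
    ext ω
    simp only [mem_preimage, mem_singleton_iff, mem_union, mem_inter_iff, mem_compl_iff,
      mem_iUnion, mem_ofPred_eq]
    by_cases h : ∃ i, IsGreatest (S ω) i
    · obtain ⟨i, hi⟩ := h
      rw [hi.csSup_eq]
      constructor
      · rintro rfl; exact Or.inl hi
      · rintro (h | ⟨h, -⟩)
        · exact hi.unique h
        · exact absurd ⟨i, hi⟩ h
    · have h0 : sSup (S ω) = 0 := by
        by_cases hne : (S ω).Nonempty
        · refine Int.csSup_of_not_bddAbove fun hb => h ⟨_, Int.csSup_mem hne hb, fun t ht => ?_⟩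
          exact le_csSup hb ht
        · rw [not_nonempty_iff_eq_empty.1 hne, Int.csSup_empty]
      rw [h0]
      constructor
      · intro h1; exact Or.inr ⟨h, h1⟩
      · rintro (h1 | ⟨-, h1⟩)
        · exact absurd ⟨j, h1⟩ h
        · exact h1
  rw [this]
  exact (hg j).union ((MeasurableSet.iUnion hg).compl.inter (MeasurableSet.const _))

variable {A B : Type} [MeasurableSpace A] [MeasurableSpace B] [DiscreteMeasurableSpace A]
  [DiscreteMeasurableSpace B]

lemma measurable_height (i : ℤ) : Measurable fun ζ : ℤ → A ⊕ B => height ζ i := by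
  have h : ∀ j : ℤ, Measurable fun ζ : ℤ → A ⊕ B => bracketSign (ζ j) := fun j =>
    (Measurable.of_discrete (f := bracketSign)).comp (measurable_pi_apply j)
  exact (Finset.measurable_fun_sum _ fun j _ => h j).sub
    (Finset.measurable_fun_sum _ fun j _ => h j)

lemma measurable_matchLeft (i : ℤ) : Measurable fun ζ : ℤ → A ⊕ B => matchLeft ζ i :=
  measurable_sSup_int fun j => (MeasurableSet.const (j < i + 1)).inter
    (measurableSet_eq_fun (measurable_height j) (measurable_height (i + 1)))

lemma measurable_stackPos (n : ℤ) (m : ℕ) : Measurable fun ζ : ℤ → A ⊕ B => stackPos ζ n m :=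
  measurable_sSup_int fun j => (MeasurableSet.const (j < n)).inter
    (measurableSet_eq_fun (measurable_height j) ((measurable_height n).sub measurable_const))

lemma measurable_flip : Measurable (flip : (ℤ → A ⊕ B) → ℤ → B ⊕ A) :=
  measurable_pi_lambda _ fun i =>
    (Measurable.of_discrete (f := Sum.swap)).comp (measurable_pi_apply (-1 - i))

variable {M : ℕ} [NeZero M]

lemma measurable_stackDigit (n : ℤ) (m : ℕ) :
    Measurable fun ζ : ℤ → Fin M ⊕ B => stackDigit ζ n m :=
  (Measurable.of_discrete (f := leftLabel)).comp
    (measurable_apply_index measurable_id (measurable_stackPos n m))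

lemma measurable_centralCoord (hM : 2 ≤ M) (n : ℤ) :
    Measurable fun ζ : ℤ → Fin M ⊕ B => centralCoord ζ n :=
  measurable_affineSeries (fun _ => (isContracting_digits hM _).summable)
    (fun _ => measurable_const) fun m =>
      (Measurable.of_discrete (f := fun k : Fin M => (k : ℝ) / M)).comp (measurable_stackDigit n m)

lemma measurable_psiAlpha : Measurable (psiAlpha M) := by
  refine measurable_pi_lambda _ fun i => ?_
  have h : (fun ζ => psiAlpha M ζ i) = (fun p : SymbAlpha M × Fin M => match p.1 with
      | Sum.inl k => Sum.inl k
      | Sum.inr _ => Sum.inr p.2) ∘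
      fun ζ => (ζ i, leftLabel (ζ (matchLeft ζ i))) := by
    funext ζ
    rcases hζ : ζ i with k | u
    · rw [psiAlpha_of_inl hζ]; simp [hζ]
    · rw [psiAlpha_of_inr hζ]; simp [hζ]
  rw [h]
  exact (measurable_of_countable _).comp ((measurable_pi_apply i).prodMk
    ((Measurable.of_discrete (f := leftLabel)).comp
      (measurable_apply_index measurable_id (measurable_matchLeft i))))

end Measurability

/-! ### Uniform Bernoulli measures -/

section Bernoulli

lemma map_toMeasure_uniformOfFintype {A B : Type} [Fintype A] [Nonempty A] [Fintype B] [Nonempty B]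
    [MeasurableSpace A] [MeasurableSpace B] [DiscreteMeasurableSpace A] [DiscreteMeasurableSpace B]
    (e : A ≃ B) :
    (PMF.uniformOfFintype A).toMeasure.map e = (PMF.uniformOfFintype B).toMeasure := by
  refine Measure.ext_of_singleton fun b => ?_
  rw [Measure.map_apply .of_discrete .of_discrete,
    show e ⁻¹' {b} = {e.symm b} by ext; simp [Equiv.eq_symm_apply],
    PMF.toMeasure_apply_singleton _ _ .of_discrete, PMF.toMeasure_apply_singleton _ _ .of_discrete,
    PMF.uniformOfFintype_apply, PMF.uniformOfFintype_apply, Fintype.card_congr e]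

/-- In a sequence of independent trials whose probabilities of success are bounded below, there is
almost surely a success; here the trials are made at the times `e 0, e 1, …`. -/
lemma ae_exists_apply_mem {A : Type} [MeasurableSpace A] (P : Measure A) [IsProbabilityMeasure P]
    {e : ℕ → ℤ} (he : Function.Injective e) {s : ℕ → Set A} (hs : ∀ i, MeasurableSet (s i))
    {c : ℝ≥0∞} (hc : c ≠ 0) (hcs : ∀ i, c ≤ P (s i)) :
    ∀ᵐ x ∂Measure.infinitePi (fun _ : ℤ => P), ∃ i, x (e i) ∈ s i := by
  have hnat : ∀ᵐ x ∂Measure.infinitePi (fun _ : ℕ => P), ∃ i, x i ∈ s i := by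
    have hle : ∀ N : ℕ,
        Measure.infinitePi (fun _ : ℕ => P) {x | ¬ ∃ i, x i ∈ s i} ≤ (1 - c) ^ N := by
      intro N
      calc Measure.infinitePi (fun _ : ℕ => P) {x | ¬ ∃ i, x i ∈ s i}
          ≤ Measure.infinitePi (fun _ : ℕ => P) (Set.pi (Finset.range N) fun i => (s i)ᶜ) :=
            measure_mono fun x hx i _ hi => hx ⟨i, hi⟩
        _ = ∏ i ∈ Finset.range N, P (s i)ᶜ := Measure.infinitePi_pi _ fun i _ => (hs i).compl
        _ ≤ ∏ _i ∈ Finset.range N, (1 - c) := Finset.prod_le_prod' fun i _ => by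
            rw [prob_compl_eq_one_sub (hs i)]
            exact tsub_le_tsub_left (hcs i) 1
        _ = (1 - c) ^ N := by simp
    have hlt : 1 - c < 1 := ENNReal.sub_lt_self one_ne_top one_ne_zero hc
    exact le_antisymm (ge_of_tendsto' (ENNReal.tendsto_pow_atTop_nhds_zero_of_lt_one hlt) hle)
      zero_le
  rw [← Measure.map_infinitePi_infinitePi_of_inj (P := fun _ : ℤ => P) he] at hnat
  have hf : Measurable fun (x : ℤ → A) (i : ℕ) => x (e i) :=
    measurable_pi_lambda _ fun i => measurable_pi_apply (e i)
  exact ae_of_ae_map hf.aemeasurable hnat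

variable {M : ℕ} [NeZero M]

instance : IsProbabilityMeasure (lambdaAlpha M) := by unfold lambdaAlpha; infer_instance

omit [NeZero M] in
lemma map_eval_lambdaAlpha (i : ℤ) :
    (lambdaAlpha M).map (fun ζ => ζ i) = (PMF.uniformOfFintype (SymbAlpha M)).toMeasure :=
  Measure.infinitePi_map_eval _ i

instance : IsProbabilityMeasure (nuAlpha M) :=
  Measure.isProbabilityMeasure_map measurable_psiAlpha.aemeasurable

omit [NeZero M] in
lemma ae_exists_symb_eq {e : ℕ → ℤ} (he : Function.Injective e) (γ : SymbAlpha M) :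
    ∀ᵐ ζ ∂lambdaAlpha M, ∃ i, ζ (e i) = γ := by
  refine ae_exists_apply_mem _ he (s := fun _ => {γ}) (fun _ => .of_discrete)
    (c := (Fintype.card (SymbAlpha M) : ℝ≥0∞)⁻¹) (ENNReal.inv_ne_zero.2 (natCast_ne_top _))
    fun i => ?_
  rw [PMF.toMeasure_apply_singleton _ _ .of_discrete, PMF.uniformOfFintype_apply]

omit [NeZero M] in
lemma sum_bracketSign_eq (ζ : ℤ → SymbAlpha M) (n : ℕ) :
    ∑ i ∈ Finset.range n, (bracketSign (ζ (-1 - i)) : ℝ) = -height ζ (-n) := by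
  induction n with
  | zero => simp [height_zero]
  | succ n ih =>
    have h := height_add_one ζ (-1 - n)
    rw [show (-1 - n + 1 : ℤ) = -n by ring] at h
    rw [Finset.sum_range_succ, ih, h, show (-((n + 1 : ℕ) : ℤ)) = -1 - n by push_cast; ring]
    push_cast
    ring

omit [NeZero M] in
lemma integral_bracketSign_pos (hM : 2 ≤ M) (i : ℤ) :
    0 < ∫ ζ, (bracketSign (ζ i) : ℝ) ∂lambdaAlpha M := by
  have h : ∫ ζ, (bracketSign (ζ i) : ℝ) ∂lambdaAlpha M =
      ∫ x, (bracketSign x : ℝ) ∂(PMF.uniformOfFintype (SymbAlpha M)).toMeasure := by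
    rw [← map_eval_lambdaAlpha i, integral_map (measurable_pi_apply i).aemeasurable
      Measurable.of_discrete.aestronglyMeasurable]
  have hM' : (2 : ℝ) ≤ M := by exact_mod_cast hM
  rw [h, PMF.integral_eq_sum]
  simp only [PMF.uniformOfFintype_apply, smul_eq_mul, ← Finset.mul_sum, Fintype.sum_sum_type,
    bracketSign, Int.cast_one, Int.cast_neg, Finset.sum_const, Finset.card_univ, Fintype.card_fin,
    Fintype.card_sum, Fintype.card_unit, nsmul_eq_mul, mul_one, one_smul]
  refine mul_pos (ENNReal.toReal_pos ?_ ?_) (by simp; linarith)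
  · exact ENNReal.inv_ne_zero.2 (natCast_ne_top _)
  · exact ENNReal.inv_ne_top.2 (by simp)

omit [NeZero M] in
/-- Left brackets are more frequent than right ones, so the law of large numbers makes the heights
tend to `-∞` in the past. -/
lemma ae_unboundedPast (hM : 2 ≤ M) : ∀ᵐ ζ ∂lambdaAlpha M, UnboundedPast ζ := by
  set X : ℕ → (ℤ → SymbAlpha M) → ℝ := fun k ζ => bracketSign (ζ (-1 - k)) with hX
  have hinj : Function.Injective fun k : ℕ => (-1 - k : ℤ) := fun k k' h => by
    simp only at h; omega
  have hmeas : ∀ k, Measurable (X k) := fun k =>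
    (Measurable.of_discrete (f := fun x : SymbAlpha M => (bracketSign x : ℝ))).comp
      (measurable_pi_apply _)
  have hind : ProbabilityTheory.iIndepFun
      (fun (i : ℤ) ζ => (bracketSign (ζ i) : ℝ)) (lambdaAlpha M) :=
    ProbabilityTheory.iIndepFun_infinitePi (fun _ => Measurable.of_discrete
      (f := fun x : SymbAlpha M => (bracketSign x : ℝ)))
  have hbound : ∀ x : SymbAlpha M, ‖(bracketSign x : ℝ)‖ ≤ 1 := by
    rintro (k | k) <;> simp [bracketSign]
  have hlaw := ProbabilityTheory.strong_law_ae_real (μ := lambdaAlpha M) X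
    (Integrable.of_bound (hmeas 0).aestronglyMeasurable 1 (ae_of_all _ fun ζ => hbound _))
    (fun i j hij => hind.indepFun (fun h => hij (hinj h)))
    (fun k => ⟨(hmeas k).aemeasurable, (hmeas 0).aemeasurable, by
      have h : ∀ i : ℤ, (lambdaAlpha M).map (fun ζ => (bracketSign (ζ i) : ℝ)) =
          (PMF.uniformOfFintype (SymbAlpha M)).toMeasure.map (fun x => (bracketSign x : ℝ)) := by
        intro i
        rw [← map_eval_lambdaAlpha i]
        exact (Measure.map_map (g := fun x : SymbAlpha M => (bracketSign x : ℝ)) .of_discrete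
          (measurable_pi_apply i)).symm
      exact (h _).trans (h _).symm⟩)
  filter_upwards [hlaw] with ζ hζ h n
  have hm := integral_bracketSign_pos hM (-1 - (0 : ℕ))
  simp only [hX, sum_bracketSign_eq] at hζ
  set m := ∫ ζ, (bracketSign (ζ (-1 - (0 : ℕ))) : ℝ) ∂lambdaAlpha M
  have h1 := hζ.eventually_const_lt (half_lt_self hm)
  have h2 := tendsto_natCast_atTop_atTop (R := ℝ) |>.eventually_ge_atTop (-h / (m / 2))
  have h3 := eventually_gt_atTop (-n).toNat
  obtain ⟨k, hk1, hk2, hk3⟩ := (h1.and (h2.and h3)).exists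
  have hk : (0 : ℝ) < k := by exact_mod_cast (by omega : 0 < k)
  refine ⟨-k, by omega, ?_⟩
  rw [lt_div_iff₀ hk] at hk1
  rw [div_le_iff₀ (by linarith)] at hk2
  have : (height ζ (-k) : ℝ) ≤ h := by nlinarith
  exact_mod_cast this

/-- Cyclic shift of the indices of the left brackets by `k`. -/
def shiftLabel (k : Fin M) : SymbAlpha M ≃ SymbAlpha M :=
  Equiv.sumCongr (Equiv.addRight k) (Equiv.refl Unit)

/-- Cyclic shift of the index of the left bracket at each position `i` by `l i`. -/
def relabel (l : ℤ → Fin M) (ζ : ℤ → SymbAlpha M) (i : ℤ) : SymbAlpha M := shiftLabel (l i) (ζ i)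

lemma map_relabel (l : ℤ → Fin M) : (lambdaAlpha M).map (relabel l) = lambdaAlpha M := by
  have h := Measure.infinitePi_map_pi
    (fun _ : ℤ => (PMF.uniformOfFintype (SymbAlpha M)).toMeasure)
    (f := fun i : ℤ => shiftLabel (l i)) fun _ => .of_discrete
  simp only [map_toMeasure_uniformOfFintype] at h
  exact h

lemma measurable_relabel :
    Measurable fun p : (ℤ → SymbAlpha M) × (ℤ → Fin M) => relabel p.2 p.1 :=
  measurable_pi_lambda _ fun i =>
    measurable_comp_countable₂ (fun k x => shiftLabel k x)
      (f := fun p : (ℤ → SymbAlpha M) × (ℤ → Fin M) => p.2 i)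
      (g := fun p : (ℤ → SymbAlpha M) × (ℤ → Fin M) => p.1 i) (by fun_prop) (by fun_prop)

lemma measurable_relabel_right (l : ℤ → Fin M) : Measurable (relabel l) :=
  measurable_pi_lambda _ fun i =>
    (Measurable.of_discrete (f := shiftLabel (l i))).comp (measurable_pi_apply i)

lemma height_relabel (l : ℤ → Fin M) (ζ : ℤ → SymbAlpha M) :
    height (relabel l ζ) = height ζ :=
  height_congr fun i => by
    rcases h : ζ i with k | k <;> simp [relabel, shiftLabel, h, bracketSign]

/-- Every index occurs on the stack. The positions on the stack depend only on which brackets are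
left and which are right, so that the cyclic shifts of their indices by independent uniform random
amounts make the digits independent and uniform; as each such shift preserves the measure, Fubini's
theorem transfers the conclusion to the original sequence. -/
lemma ae_exists_stackDigit_eq (hM : 2 ≤ M) (n : ℤ) (k : Fin M) :
    ∀ᵐ ζ ∂lambdaAlpha M, ∃ m, stackDigit ζ n m = k := by
  set L : Measure (ℤ → Fin M) :=
    Measure.infinitePi fun _ : ℤ => (PMF.uniformOfFintype (Fin M)).toMeasure with hL
  have h1 : ∀ᵐ ζ ∂lambdaAlpha M, ∀ᵐ l ∂L, ∃ m, stackDigit (relabel l ζ) n m = k := by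
    filter_upwards [ae_unboundedPast hM] with ζ hζ
    have hex : ∀ᵐ l ∂L, ∃ m, l (stackPos ζ n m) ∈ ({k - stackDigit ζ n m} : Set (Fin M)) := by
      refine ae_exists_apply_mem _ (stackPos_injective hζ n) (fun _ => .of_discrete)
        (c := (Fintype.card (Fin M) : ℝ≥0∞)⁻¹) (ENNReal.inv_ne_zero.2 (natCast_ne_top _))
        fun i => ?_
      rw [PMF.toMeasure_apply_singleton _ _ .of_discrete, PMF.uniformOfFintype_apply]
    filter_upwards [hex] with l hl
    refine hl.imp fun m hm => ?_
    obtain ⟨d, hd⟩ := Sum.isLeft_iff.1 (isLeft_stackPos hζ n m)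
    simp only [stackDigit, hd, leftLabel, mem_singleton_iff] at hm
    simp [stackDigit, stackPos_congr (height_relabel l ζ), relabel, hd, shiftLabel, leftLabel, hm]
  have hmeas : MeasurableSet {ζ : ℤ → SymbAlpha M | ∃ m, stackDigit ζ n m = k} := by
    simp only [ofPred_exists]
    exact MeasurableSet.iUnion fun m => measurable_stackDigit n m (measurableSet_singleton k)
  rw [Measure.ae_ae_comm (p := fun ζ l => ∃ m, stackDigit (relabel l ζ) n m = k)
    (measurable_relabel hmeas)] at h1
  obtain ⟨l, hl⟩ := h1.exists
  rw [← map_relabel l]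
  exact (ae_map_iff (measurable_relabel_right l).aemeasurable hmeas).2 hl

lemma measurableSet_stackCodes (hM : 2 ≤ M) : MeasurableSet (stackCodes M) := by
  have hsymb : ∀ (i : ℤ) (S : Set (Symb M)), MeasurableSet {ω : ℤ → Symb M | ω i ∈ S} :=
    fun i S => measurable_pi_apply i (.of_discrete : MeasurableSet S)
  have hex : ∀ (S : Set (Symb M)) (g : ℤ → ℕ → ℤ),
      MeasurableSet {ω : ℤ → Symb M | ∀ n : ℤ, ∃ i : ℕ, ω (g n i) ∈ S} := by
    intro S g
    simp only [ofPred_forall, ofPred_exists]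
    exact MeasurableSet.iInter fun n => MeasurableSet.iUnion fun i => hsymb _ S
  have hpast : MeasurableSet {ω : ℤ → Symb M | UnboundedPast ω} := by
    simp only [UnboundedPast, ofPred_forall, ofPred_exists]
    exact MeasurableSet.iInter fun h => MeasurableSet.iInter fun n => MeasurableSet.iUnion fun t =>
      (MeasurableSet.const (t < n)).inter (measurableSet_le (measurable_height t) measurable_const)
  have hC := measurable_centralCoord (M := M) (B := Fin M) hM
  have hstep : ∀ (n : ℤ) (γ : Symb M), MeasurableSet {ω : ℤ → Symb M |
      CentralStep M γ (centralCoord ω n) (centralCoord ω (n + 1))} := by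
    rintro n (k | k)
    · exact measurableSet_eq_fun (hC _) (((hC _).add_const _).div_const _)
    · exact measurableSet_eq_fun (hC _) (((hC _).add_const _).div_const _)
  have hcentral : MeasurableSet {ω : ℤ → Symb M | IsCentralOrbit ω (centralCoord ω)} := by
    have : {ω : ℤ → Symb M | IsCentralOrbit ω (centralCoord ω)} =
        ⋂ n : ℤ, {ω | centralCoord ω n ∈ Ioo (0 : ℝ) 1} ∩ ⋃ γ : Symb M, {ω | ω n ∈ ({γ} : Set _)} ∩
          {ω | CentralStep M γ (centralCoord ω n) (centralCoord ω (n + 1))} := by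
      ext ω
      simp [IsCentralOrbit]
    rw [this]
    exact MeasurableSet.iInter fun n => (hC n measurableSet_Ioo).inter
      (MeasurableSet.iUnion fun γ => (hsymb n _).inter (hstep n γ))
  exact hpast.inter (hcentral.inter ((hex {γ | γ.isLeft} fun n i => n + i).inter
    ((hex {γ | γ.isRight} fun n i => n + i).inter ((hex {γ | γ.isLeft} fun n i => n - 1 - i).inter
      (hex {γ | γ.isRight} fun n i => n - 1 - i)))))

lemma ae_mem_stackCodes (hM : 2 ≤ M) : ∀ᵐ ω ∂nuAlpha M, ω ∈ stackCodes M := by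
  have hf : ∀ n : ℤ, Function.Injective fun i : ℕ => n + (i : ℤ) := fun n i j h => by
    simp only at h; omega
  have hp : ∀ n : ℤ, Function.Injective fun i : ℕ => n - 1 - (i : ℤ) := fun n i j h => by
    simp only at h; omega
  refine (ae_map_iff measurable_psiAlpha.aemeasurable (measurableSet_stackCodes hM)).2 ?_
  filter_upwards [ae_unboundedPast hM,
    ae_all_iff.2 fun n => ae_all_iff.2 fun k => ae_exists_stackDigit_eq hM n k,
    ae_all_iff.2 fun n => ae_exists_symb_eq (hf n) (Sum.inl (0 : Fin M)),
    ae_all_iff.2 fun n => ae_exists_symb_eq (M := M) (hf n) (Sum.inr ()),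
    ae_all_iff.2 fun n => ae_exists_symb_eq (hp n) (Sum.inl (0 : Fin M)),
    ae_all_iff.2 fun n => ae_exists_symb_eq (M := M) (hp n) (Sum.inr ())]
    with ζ h0 hd h1 h2 h3 h4
  refine ⟨?_, isCentralOrbit_psiAlpha hM hd, ?_⟩
  · unfold UnboundedPast
    rwa [height_psiAlpha]
  · simp only [isLeft_psiAlpha, isRight_psiAlpha]
    exact ⟨fun n => (h1 n).imp fun i hi => by rw [hi]; rfl,
      fun n => (h2 n).imp fun i hi => by rw [hi]; rfl,
      fun n => (h3 n).imp fun i hi => by rw [hi]; rfl,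
      fun n => (h4 n).imp fun i hi => by rw [hi]; rfl⟩

lemma ae_isRegular_nuAlpha (hM : 2 ≤ M) :
    ∀ᵐ ω ∂nuAlpha M, IsRegular ω (centralCoord ω 0) :=
  (ae_mem_stackCodes hM).mono fun _ hω => isRegular_of_mem_stackCodes hM hω

/-- Time reversal takes `λ_β` to `λ_α`. -/
lemma map_flip_lambdaBeta : (lambdaBeta M).map flip = lambdaAlpha M := by
  have hinj : Function.Injective fun i : ℤ => -1 - i := fun i j h => by
    simp only at h; omega
  have h1 := Measure.map_infinitePi_infinitePi_of_inj
    (P := fun _ : ℤ => (PMF.uniformOfFintype (SymbBeta M)).toMeasure) hinj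
  have h2 := Measure.infinitePi_map_pi
    (fun _ : ℤ => (PMF.uniformOfFintype (SymbBeta M)).toMeasure)
    (f := fun _ : ℤ => Equiv.sumComm Unit (Fin M)) fun _ => .of_discrete
  simp only [map_toMeasure_uniformOfFintype] at h2
  have hs : Measurable fun (x : ℤ → SymbBeta M) i => Equiv.sumComm Unit (Fin M) (x i) :=
    measurable_pi_lambda _ fun i => Measurable.of_discrete.comp (measurable_pi_apply i)
  have hr : Measurable fun (x : ℤ → SymbBeta M) (i : ℤ) => x (-1 - i) := by fun_prop
  have h3 := Measure.map_map (μ := lambdaBeta M) hs hr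
  exact h3.symm.trans ((congrArg _ h1).trans h2)

lemma nuBeta_eq_map_flip : nuBeta M = (nuAlpha M).map flip := by
  unfold nuBeta nuAlpha
  rw [← map_flip_lambdaBeta, Measure.map_map measurable_psiAlpha measurable_flip,
    Measure.map_map measurable_flip (measurable_psiAlpha.comp measurable_flip)]
  congr 1
  funext ζ
  exact psiBeta_eq_flip ζ

instance : IsProbabilityMeasure (nuBeta M) := by
  rw [nuBeta_eq_map_flip]
  exact Measure.isProbabilityMeasure_map measurable_flip.aemeasurable

lemma ae_isRegular_nuBeta (hM : 2 ≤ M) :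
    ∀ᵐ ω ∂nuBeta M, IsRegular ω (centralCoord (flip ω) 0) := by
  have h : ∀ᵐ ω ∂nuBeta M, flip ω ∈ stackCodes M := by
    rw [nuBeta_eq_map_flip]
    refine (ae_map_iff measurable_flip.aemeasurable
      (measurable_flip (measurableSet_stackCodes hM))).2 ?_
    simpa only [flip_flip] using ae_mem_stackCodes hM
  filter_upwards [h] with ω hω
  simpa only [flip_flip] using (isRegular_of_mem_stackCodes hM hω).flip

end Bernoulli

/-! ### Dependence on the parameters -/

section Continuity

variable {M : ℕ}

lemma continuous_rate_shift (γ : Symb M) :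
    Continuous (fun a => rateU M a γ) ∧ Continuous (fun a => shiftU M a γ) ∧
      Continuous (fun b => rateS M b γ) ∧ Continuous (fun b => shiftS M b γ) := by
  rcases γ with k | k <;> simp only [rateU, shiftU, rateS, shiftS] <;>
    exact ⟨by fun_prop, by fun_prop, by fun_prop, by fun_prop⟩

/-- On a neighbourhood of each parameter the rates of contraction are bounded away from `1`. -/
lemma exists_nhds_rate_le (hM : 2 ≤ M) {a : ℝ} (ha : a ∈ Ioo 0 (1 / (M : ℝ))) :
    ∃ ρ < 1, ∃ s ∈ 𝓝 a, ∀ x ∈ s, x ∈ Ioo 0 (1 / (M : ℝ)) ∧ x ≤ ρ ∧ 1 - M * x ≤ ρ := by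
  have h1 : ∀ᶠ x : ℝ in 𝓝 a, max x (1 - M * x) < (max a (1 - M * a) + 1) / 2 :=
    (by fun_prop : Continuous fun x : ℝ => max x (1 - M * x)).continuousAt.eventually_lt_const
      (by linarith [max_rate_lt_one hM ha])
  refine ⟨(max a (1 - M * a) + 1) / 2, by linarith [max_rate_lt_one hM ha], _,
    (isOpen_Ioo.eventually_mem ha).and h1, fun x hx => ⟨hx.1, ?_, ?_⟩⟩
  · exact (le_max_left _ _).trans hx.2.le
  · exact (le_max_right _ _).trans hx.2.le

lemma continuousOn_coordU (hM : 2 ≤ M) (ω : ℤ → Symb M) :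
    ContinuousOn (fun a => coordU M a ω 0) (Ioo 0 (1 / (M : ℝ))) := by
  intro a ha
  obtain ⟨ρ, hρ, s, hs, h⟩ := exists_nhds_rate_le hM ha
  have hcont := continuousOn_affineSeries (ρ := ρ) (s := s)
    (r := fun a (i : ℕ) => rateU M a (ω (0 + (i : ℤ))))
    (t := fun a (i : ℕ) => shiftU M a (ω (0 + (i : ℤ))))
    (fun x hx => isContracting_u (h x hx).1 (h x hx).2.1 (h x hx).2.2 hρ _)
    (fun _ => (continuous_rate_shift _).1.continuousOn)
    (fun _ => (continuous_rate_shift _).2.1.continuousOn)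
  exact (hcont.continuousAt hs).continuousWithinAt

lemma continuousOn_coordS (hM : 2 ≤ M) (ω : ℤ → Symb M) :
    ContinuousOn (fun b => coordS M b ω 0) (Ioo 0 (1 / (M : ℝ))) := by
  intro b hb
  obtain ⟨ρ, hρ, s, hs, h⟩ := exists_nhds_rate_le hM hb
  have hcont := continuousOn_affineSeries (ρ := ρ) (s := s)
    (r := fun b (i : ℕ) => rateS M b (ω (0 - 1 - (i : ℤ))))
    (t := fun b (i : ℕ) => shiftS M b (ω (0 - 1 - (i : ℤ))))
    (fun x hx => isContracting_s (h x hx).1 (h x hx).2.1 (h x hx).2.2 hρ _)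
    (fun _ => (continuous_rate_shift _).2.2.1.continuousOn)
    (fun _ => (continuous_rate_shift _).2.2.2.continuousOn)
  exact (hcont.continuousAt hs).continuousWithinAt

lemma measurable_coordU (hM : 2 ≤ M) {a : ℝ} (ha : a ∈ Ioo 0 (1 / (M : ℝ))) :
    Measurable fun ω : ℤ → Symb M => coordU M a ω 0 :=
  measurable_affineSeries
    (fun ω => (isContracting_u ha (le_max_left _ _) (le_max_right _ _) (max_rate_lt_one hM ha)
      (fun i : ℕ => ω (0 + i))).summable)
    (fun _ => (Measurable.of_discrete (f := rateU M a)).comp (measurable_pi_apply _))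
    (fun _ => (Measurable.of_discrete (f := shiftU M a)).comp (measurable_pi_apply _))

lemma measurable_coordS (hM : 2 ≤ M) {b : ℝ} (hb : b ∈ Ioo 0 (1 / (M : ℝ))) :
    Measurable fun ω : ℤ → Symb M => coordS M b ω 0 :=
  measurable_affineSeries
    (fun ω => (isContracting_s hb (le_max_left _ _) (le_max_right _ _) (max_rate_lt_one hM hb)
      (fun i : ℕ => ω (0 - 1 - i))).summable)
    (fun _ => (Measurable.of_discrete (f := rateS M b)).comp (measurable_pi_apply _))
    (fun _ => (Measurable.of_discrete (f := shiftS M b)).comp (measurable_pi_apply _))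

/-- The point with code `ω`, if its `x_c`-coordinate is `C ω`. Unlike `decode` it is defined by
convergent series for every `ω`, which makes it measurable in `ω` and continuous in the
parameters. -/
noncomputable def codedPoint (M : ℕ) (C : (ℤ → Symb M) → ℝ) (q : Delta M) (ω : ℤ → Symb M) : Cube :=
  (projIcc 0 1 zero_le_one (coordU M q.1.1 ω 0), projIcc 0 1 zero_le_one (C ω),
    projIcc 0 1 zero_le_one (coordS M q.1.2 ω 0))

lemma decode_eq_codedPoint (hM : 2 ≤ M) (C : (ℤ → Symb M) → ℝ) (q : Delta M) {ω : ℤ → Symb M}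
    (hω : IsRegular ω (C ω)) : decode M q.1.1 q.1.2 ω = codedPoint M C q ω := by
  have h := toReal_decode q.2.1 q.2.2 hM hω
  simp only [Cube.toReal, Prod.mk.injEq] at h
  obtain ⟨h1, h2, h3⟩ := h
  simp only [codedPoint, ← h1, ← h2, ← h3, projIcc_val]

lemma continuous_codedPoint (hM : 2 ≤ M) (C : (ℤ → Symb M) → ℝ) (ω : ℤ → Symb M) :
    Continuous fun q => codedPoint M C q ω := by
  have h1 : Continuous fun q : Delta M => coordU M q.1.1 ω 0 :=
    (continuousOn_coordU hM ω).comp_continuous (by fun_prop) fun q => q.2.1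
  have h2 : Continuous fun q : Delta M => coordS M q.1.2 ω 0 :=
    (continuousOn_coordS hM ω).comp_continuous (by fun_prop) fun q => q.2.2
  exact (continuous_projIcc.comp h1).prodMk
    (continuous_const.prodMk (continuous_projIcc.comp h2))

lemma measurable_codedPoint (hM : 2 ≤ M) {C : (ℤ → Symb M) → ℝ} (hC : Measurable C)
    (q : Delta M) : Measurable (codedPoint M C q) :=
  (continuous_projIcc.measurable.comp (measurable_coordU hM q.2.1)).prodMk
    ((continuous_projIcc.measurable.comp hC).prodMk
      (continuous_projIcc.measurable.comp (measurable_coordS hM q.2.2)))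

/-- If almost every code is regular, then the image measures under the inverse of the coding map
depend continuously on the parameters, by dominated convergence. -/
theorem exists_continuous_map_decode (hM : 2 ≤ M) (ν : Measure (ℤ → Symb M))
    [IsProbabilityMeasure ν] {C : (ℤ → Symb M) → ℝ} (hC : Measurable C)
    (hreg : ∀ᵐ ω ∂ν, IsRegular ω (C ω)) :
    ∃ μ : Delta M → ProbabilityMeasure Cube,
      (∀ q, (μ q : Measure Cube) = ν.map (decode M q.1.1 q.1.2)) ∧ Continuous μ := by
  have hmeas := measurable_codedPoint hM hC
  let μ : Delta M → ProbabilityMeasure Cube := fun q => ⟨ν.map (codedPoint M C q),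
    Measure.isProbabilityMeasure_map (hmeas q).aemeasurable⟩
  refine ⟨μ, fun q => ?_, ?_⟩
  · refine Measure.map_congr ?_
    filter_upwards [hreg] with ω hω
    exact (decode_eq_codedPoint hM C q hω).symm
  · rw [continuous_iff_continuousAt]
    intro q
    refine ProbabilityMeasure.tendsto_iff_forall_integral_tendsto.2 fun f => ?_
    have hint : ∀ q, ∫ x, f x ∂(ν.map (codedPoint M C q)) = ∫ ω, f (codedPoint M C q ω) ∂ν :=
      fun q => integral_map (hmeas q).aemeasurable f.continuous.aestronglyMeasurable
    have hcont : Continuous fun q => ∫ ω, f (codedPoint M C q ω) ∂ν :=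
      continuous_of_dominated
        (fun q => (f.continuous.measurable.comp (hmeas q)).aestronglyMeasurable)
        (fun q => ae_of_all _ fun ω => f.norm_coe_le_norm _) (integrable_const ‖f‖)
        (ae_of_all _ fun ω => f.continuous.comp (continuous_codedPoint hM C ω))
    simpa only [μ, ProbabilityMeasure.coe_mk, hint] using hcont.tendsto q

end Continuity

end HeterochaosBaker

/-- Both families consist of Borel probability measures on the cube, and they depend continuously
on the parameters; so do, for fixed `b`, their projections to the square. The topology of
`ProbabilityMeasure` is the weak* topology, that is, convergence of the integrals of all (bounded)
continuous functions. -/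
theorem theorem2p4 (M : ℕ) [NeZero M] (hM : 2 ≤ M) :
    ∃ μα μβ : HeterochaosBaker.Delta M → ProbabilityMeasure HeterochaosBaker.Cube,
      (∀ q, (μα q : Measure HeterochaosBaker.Cube) =
        HeterochaosBaker.muAlpha M q.1.1 q.1.2) ∧
      (∀ q, (μβ q : Measure HeterochaosBaker.Cube) =
        HeterochaosBaker.muBeta M q.1.1 q.1.2) ∧
      (Continuous μα ∧ Continuous μβ) ∧
      ∀ (b : ℝ) (hb : b ∈ Ioo 0 (1 / (M : ℝ))),
        (Continuous fun a : Ioo (0 : ℝ) (1 / (M : ℝ)) =>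
          (μα ⟨((a : ℝ), b), ⟨a.2, hb⟩⟩).map HeterochaosBaker.measurable_proj.aemeasurable) ∧
        (Continuous fun a : Ioo (0 : ℝ) (1 / (M : ℝ)) =>
          (μβ ⟨((a : ℝ), b), ⟨a.2, hb⟩⟩).map HeterochaosBaker.measurable_proj.aemeasurable) := by
  obtain ⟨μα, hα, hcα⟩ := HeterochaosBaker.exists_continuous_map_decode hM
    (HeterochaosBaker.nuAlpha M) (HeterochaosBaker.measurable_centralCoord hM 0)
    (HeterochaosBaker.ae_isRegular_nuAlpha hM)
  obtain ⟨μβ, hβ, hcβ⟩ := HeterochaosBaker.exists_continuous_map_decode hM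
    (HeterochaosBaker.nuBeta M)
    ((HeterochaosBaker.measurable_centralCoord hM 0).comp HeterochaosBaker.measurable_flip)
    (HeterochaosBaker.ae_isRegular_nuBeta hM)
  have hproj : Continuous HeterochaosBaker.proj := by
    unfold HeterochaosBaker.proj
    fun_prop
  refine ⟨μα, μβ, hα, hβ, ⟨hcα, hcβ⟩, fun b hb => ?_⟩
  have hpair : Continuous fun a : Ioo (0 : ℝ) (1 / (M : ℝ)) =>
      (⟨((a : ℝ), b), ⟨a.2, hb⟩⟩ : HeterochaosBaker.Delta M) := by
    fun_prop
  exact ⟨(ProbabilityMeasure.continuous_map hproj).comp (hcα.comp hpair),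
    (ProbabilityMeasure.continuous_map hproj).comp (hcβ.comp hpair)⟩
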